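/- Circuits are acyclic sequences of layers on a register of qubits. A layer is either a set of elementary gates acting on pairwise disjoint sets of qubits, or a simultaneous measurement, in the computational basis, of some of the qubits. The elementary gates are arbitrary one-qubit unitaries and CNOT gates; with feedback, a one-qubit unitary may be chosen as an arbitrary function of all earlier measurement outcomes. The depth of a circuit is its total number of layers, and its size is its total number of gates and one-qubit measurements. Theorem. There are absolute constants $D$ and $K$ such that the following holds for every integer $n\ge 0$ and all real numbers $\alpha_j\in[0,1]$ and $\theta_j\in[0,2\pi)$, $0\le j\le 2^n-1$, with $\sum_{j=0}^{2^n-1}\alpha_j^2=1$. There exists a circuit with intermediate measurements and feedback, on $n$ qubits and at most $K\,n4^n$ ancilla qubits, that has depth at most $D$, size at most $K\,n4^n$ and at most $31$ layers of measurements, and that prepares the $n$-qubit state $$\sum_{j=0}^{2^n-1}\alpha_j e^{i\theta_j}\,|j\rangle$$ from the initial state $|0\rangle^{\otimes n}$, the ancilla qubits starting and ending in the state $|0\rangle$: for all measurement outcomes of nonzero probability, the final state of the whole register is, up to a global phase, this state tensored with $|0\cdots0\rangle$. Here $|j\rangle=|j_1\cdots j_n\rangle$, where $j_1\cdots j_n$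 is the $n$-bit binary representation of $j$, most significant bit first. -/

import Mathlib

namespace DynamicCircuit

/-- Amplitude vectors of an `m`-qubit register in the computational basis: the value at
`x : Fin m → Bool` is the coefficient of `|x₀ x₁ … x_{m-1}⟩` (`false` is `0`, `true` is `1`). -/
abbrev QVec (m : ℕ) : Type := (Fin m → Bool) → ℂ

/-- The computational basis vector `|x⟩`. -/
def ket {m : ℕ} (x : Fin m → Bool) : QVec m := Pi.single x 1

/-- A classical record: the outcomes of the measurement layers performed so far, in chronological
order. The entry of a layer lists the outcome of each qubit measured in that layer, and is `false`
at the qubits that were not measured. -/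
abbrev Record (m : ℕ) : Type := List (Fin m → Bool)

/-- Elementary gates: an arbitrary one-qubit unitary, which may be chosen by an arbitrary classical
computation from the outcomes measured so far (feedback), or a CNOT. -/
inductive Gate (m : ℕ) : Type
  | single (i : Fin m) (U : Record m → Matrix.unitaryGroup Bool ℂ)
  | cnot (control target : Fin m) (h : control ≠ target)

/-- The qubits on which a gate acts. -/
def Gate.support {m : ℕ} : Gate m → Finset (Fin m)
  | .single i _ => {i}
  | .cnot c t _ => {c, t}

/-- The action of a gate on an amplitude vector, given the classical record `r`. -/
def Gate.apply {m : ℕ} (r : Record m) : Gate m → QVec m → QVec m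
  | .single i U, v => fun x =>
      ∑ b : Bool, (U r : Matrix Bool Bool ℂ) (x i) b * v (Function.update x i b)
  | .cnot c t _, v => fun x => v (Function.update x t (xor (x t) (x c)))

/-- One time step of a circuit: gates acting in parallel on pairwise disjoint sets of qubits, or
a simultaneous computational-basis measurement of the qubits in `S`. -/
inductive Layer (m : ℕ) : Type
  | gates (L : List (Gate m))
      (disjoint : L.Pairwise fun g g' => Disjoint g.support g'.support)
  | measure (S : Finset (Fin m))

/-- A circuit with intermediate measurements and feedback, as the list of its layers. -/
abbrev Circuit (m : ℕ) : Type := List (Layer m)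

/-- The number of elementary operations (gates and one-qubit measurements) in a layer. -/
def Layer.size {m : ℕ} : Layer m → ℕ
  | .gates L _ => L.length
  | .measure S => S.card

/-- Whether the layer is a measurement layer. -/
def Layer.isMeasure {m : ℕ} : Layer m → Bool
  | .gates _ _ => false
  | .measure _ => true

/-- The depth: the total number of layers, gate layers and measurement layers alike. -/
def Circuit.depth {m : ℕ} (C : Circuit m) : ℕ := C.length

/-- The size: the total number of gates and one-qubit measurements. -/
def Circuit.size {m : ℕ} (C : Circuit m) : ℕ := (C.map Layer.size).sum

/-- The number of layers of intermediate measurements. -/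
def Circuit.measureLayers {m : ℕ} (C : Circuit m) : ℕ := C.countP Layer.isMeasure

/-- The projection onto the outcome `b` of the measurement of the qubits in `S`, without
renormalization. -/
def project {m : ℕ} (S : Finset (Fin m)) (b : Fin m → Bool) (v : QVec m) : QVec m :=
  fun x => if ∀ i ∈ S, x i = b i then v x else 0

/-- Execution of a circuit along one measurement branch: `o k i` is the outcome of qubit `i` in the
`k`-th measurement layer, if it is measured there. The final vector is not renormalized: its squared
norm, relative to that of the initial vector, is the probability of the branch. -/
def Circuit.runFrom {m : ℕ} (o : ℕ → Fin m → Bool) :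
    List (Layer m) → Record m → QVec m → QVec m
  | [], _, v => v
  | .gates L _ :: C, r, v => Circuit.runFrom o C r (L.foldl (fun w g => g.apply r w) v)
  | .measure S :: C, r, v =>
      Circuit.runFrom o C (r ++ [fun i => if i ∈ S then o r.length i else false])
        (project S (o r.length) v)

/-- Execution from the initial state `|0⟩^m`, along one measurement branch. -/
def Circuit.run {m : ℕ} (C : Circuit m) (o : ℕ → Fin m → Bool) : QVec m :=
  Circuit.runFrom o C [] (ket fun _ => false)

/-- The vector `ψ ⊗ |0⟩^a`. -/
def withZeros {n : ℕ} (a : ℕ) (ψ : QVec n) : QVec (n + a) := fun x =>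
  if ∀ k : Fin a, x (Fin.natAdd n k) = false then ψ (fun i => x (Fin.castAdd a i)) else 0

/-- The circuit, on `n` qubits and `a` ancillas, prepares the `n`-qubit state `ψ` from
`|0⟩^n` with ancillas starting and ending in `|0⟩^a`: along every measurement branch the final
vector is a multiple of `ψ ⊗ |0⟩^a`. The multiple may depend on the branch: it consists of the
square root of the probability of the branch (`0` for an impossible branch) and a global phase. -/
def Circuit.Prepares {n a : ℕ} (C : Circuit (n + a)) (ψ : QVec n) : Prop :=
  ∀ o : ℕ → Fin (n + a) → Bool, ∃ c : ℂ, C.run o = c • withZeros a ψ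

/-- The bit string of the `n`-bit binary representation of `j`, the most significant bit first. -/
def bits {n : ℕ} (j : Fin (2 ^ n)) : Fin n → Bool := fun i => (j : ℕ).testBit (i.rev : ℕ)

/-- The vector `∑_j α_j e^{iθ_j} |j⟩`. -/
noncomputable def polarState {n : ℕ} (α θ : Fin (2 ^ n) → ℝ) : QVec n :=
  ∑ j : Fin (2 ^ n), ((α j : ℂ) * Complex.exp (Complex.I * (θ j : ℂ))) • ket (bits j)

end DynamicCircuit

namespace DynamicCircuit

open Function

/-! Measurement with feedback makes Boolean-linear maps cheap: `Prep.linear_of_constraints` adds `M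
y` to an output register in constant depth whenever `M` is the solution of a sparse invertible
system of parity constraints. Auxiliary qubits in uniform superposition carry candidate values of
the variables, the violated constraints are measured, and a Pauli `X` correction turns the
candidates into the true solution. After use, the variables are measured in the Hadamard basis,
which leaves only a sign linear in `y`, removed by `Z` gates. Chains of copies and partial sums form
such systems, so all parities and fan-outs cost constant depth (`Prep.linear`).

By Walsh expansion every phase function of few bits is a sum of phases on parities, hence costs
constant depth (`Prep.diagonal`); conjugating sign functions by Hadamard gates gives unbounded
fan-in conjunctions (`Prep.conjunction`).

For the state itself, view the amplitudes as products of conditional amplitudes along the branches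
of a binary tree (`exists_amplitudes`). One qubit per inner node is prepared in its conditional
state, all in parallel. Following the node bits from the root selects exactly one leaf, with the
right amplitude; conjunctions write that leaf in unary. In unary the phases are one-qubit gates and
every function of the leaf is linear: the output string, the node bits on the path and the path
indicators are all obtained by linear maps. The nodes off the path must return to `|0⟩` while those
on the path stay there. Each node state is `W X W⁻¹ |0⟩`, so this conditional inverse needs a single
CNOT between one-qubit gates. Finally the unary leaf is erased by conjunctions on the output
register. -/

/-- Amplitude vectors of a register whose wires are indexed by `ι`. -/
abbrev QV (ι : Type) : Type := (ι → Bool) → ℂ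

open Classical in
/-- The indicator of a proposition, as a complex number. -/
noncomputable def ind (p : Prop) : ℂ := if p then 1 else 0

theorem ind_true {p : Prop} (h : p) : ind p = 1 := by simp [ind, h]

theorem ind_false {p : Prop} (h : ¬p) : ind p = 0 := by simp [ind, h]

theorem ind_and (p q : Prop) : ind (p ∧ q) = ind p * ind q := by
  by_cases hp : p <;> by_cases hq : q <;> simp [ind, hp, hq]

theorem ind_mul_congr {p : Prop} {a b : ℂ} (h : p → a = b) : ind p * a = ind p * b := by
  by_cases hp : p
  · rw [h hp]
  · simp [ind_false hp]

/-! ### Parallel layers of gates as operators on amplitude vectors -/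

section Operations

variable {ι T : Type}

/-- The parallel action of the one-qubit operators `U t` on the wires `w t`. -/
noncomputable def parOp [Fintype T] [DecidableEq T] (w : T → ι)
    (U : T → Matrix Bool Bool ℂ) (v : QV ι) : QV ι := fun x =>
  ∑ b : T → Bool, (∏ t, U t (x (w t)) (b t)) * v (extend w b x)

theorem extend_extend {w : T → ι} (hw : Injective w) (b c : T → Bool) (x : ι → Bool) :
    extend w c (extend w b x) = extend w c x := by
  funext i
  by_cases h : ∃ t, w t = i
  · obtain ⟨t, rfl⟩ := h
    simp [hw.extend_apply]
  · simp [extend_apply' _ _ _ h]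

theorem extend_self (w : T → ι) (x : ι → Bool) : extend w (fun t => x (w t)) x = x := by
  funext i
  by_cases h : ∃ t, w t = i
  · have := Classical.choose_spec h
    simp only [extend, h, dif_pos, this]
  · simp [extend_apply' _ _ _ h]

theorem parOp_parOp [Fintype T] [DecidableEq T] {w : T → ι} (hw : Injective w)
    (U V : T → Matrix Bool Bool ℂ) (v : QV ι) :
    parOp w U (parOp w V v) = parOp w (fun t => U t * V t) v := by
  funext x
  simp only [parOp, hw.extend_apply, extend_extend hw, Finset.mul_sum]
  rw [Finset.sum_comm]
  refine Finset.sum_congr rfl fun c _ => ?_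
  simp only [Matrix.mul_apply, Fintype.prod_sum, Finset.prod_mul_distrib, Finset.sum_mul, mul_assoc]

theorem parOp_diagonal [Fintype T] [DecidableEq T] (w : T → ι) (d : T → Bool → ℂ) (v : QV ι) (x : ι → Bool) :
    parOp w (fun t => Matrix.diagonal (d t)) v x = (∏ t, d t (x (w t))) * v x := by
  rw [parOp, Fintype.sum_eq_single (fun t => x (w t))]
  · rw [extend_self]; simp
  · intro b hb
    obtain ⟨t, ht⟩ : ∃ t, b t ≠ x (w t) := by
      by_contra! h; exact hb (funext h)
    rw [Finset.prod_eq_zero (Finset.mem_univ t), zero_mul]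
    simp [Matrix.diagonal, ht.symm]

theorem parOp_one [Fintype T] [DecidableEq T] (w : T → ι) (v : QV ι) : parOp w (fun _ => 1) v = v := by
  funext x
  have := parOp_diagonal w (fun _ _ => 1) v x
  simpa using this

/-- The operator `X^b`. -/
noncomputable def flipMatrix (b : Bool) : Matrix Bool Bool ℂ :=
  fun i j => if j = i + b then 1 else 0

theorem parOp_flip [Fintype T] [DecidableEq T] (w : T → ι) (m : T → Bool) (v : QV ι) (x : ι → Bool) :
    parOp w (fun t => flipMatrix (m t)) v x = v (extend w (fun t => x (w t) + m t) x) := by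
  rw [parOp, Fintype.sum_eq_single (fun t => x (w t) + m t)]
  · simp [flipMatrix]
  · intro b hb
    obtain ⟨t, ht⟩ : ∃ t, b t ≠ x (w t) + m t := by
      by_contra! h; exact hb (funext h)
    rw [Finset.prod_eq_zero (Finset.mem_univ t), zero_mul]
    simp [flipMatrix, ht]

/-- The parallel action of CNOT gates with controls `c t` and targets `d t`. -/
noncomputable def cnotOp (c d : T → ι) (v : QV ι) : QV ι := fun x =>
  v (extend d (fun t => x (d t) + x (c t)) x)

theorem parOp_smul [Fintype T] [DecidableEq T] (w : T → ι) (U : T → Matrix Bool Bool ℂ)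
    (a : ℂ) (v : QV ι) :
    parOp w U (a • v) = a • parOp w U v := by
  funext x
  simp only [parOp, Pi.smul_apply, smul_eq_mul, Finset.mul_sum]
  exact Finset.sum_congr rfl fun b _ => by ring

end Operations

/-! ### Adaptive reachability between families of states -/

/-- `Reaches σ v w d s k`: given classical information of type `σ`, there is a circuit with feedback
of depth at most `d`, size at most `s` and at most `k` measurement layers that maps `v p` to a
multiple of `w p` along every branch, for every `p : σ`. -/
inductive Reaches {ι : Type} : (σ : Type) → (σ → QV ι) → (σ → QV ι) → ℕ → ℕ → ℕ → Prop
  | done (σ : Type) (v w : σ → QV ι) (d s k : ℕ) (h : ∀ p, ∃ a : ℂ, v p = a • w p) :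
      Reaches σ v w d s k
  | single (σ : Type) (v w : σ → QV ι) (d s s' k : ℕ) (T : Type) [Fintype T] [DecidableEq T]
      (q : T → ι) (hq : Injective q) (U : σ → T → Matrix.unitaryGroup Bool ℂ)
      (hs : Fintype.card T + s ≤ s')
      (h : Reaches σ (fun p => parOp q (fun t => (U p t : Matrix Bool Bool ℂ)) (v p)) w d s k) :
      Reaches σ v w (d + 1) s' k
  | cnot (σ : Type) (v w : σ → QV ι) (d s s' k : ℕ) (T : Type) [Fintype T] [DecidableEq T]
      (c t : T → ι) (hc : Injective c) (ht : Injective t) (hct : ∀ a b, c a ≠ t b)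
      (hs : Fintype.card T + s ≤ s')
      (h : Reaches σ (fun p => cnotOp c t (v p)) w d s k) :
      Reaches σ v w (d + 1) s' k
  | measure (σ : Type) (v w : σ → QV ι) (d s s' k : ℕ) (T : Type) [Fintype T] [DecidableEq T]
      (q : T → ι) (hq : Injective q)
      (hs : Fintype.card T + s ≤ s')
      (h : Reaches (σ × (T → Bool)) (fun p x => ind (∀ t, x (q t) = p.2 t) * v p.1 x)
        (fun p => w p.1) d s k) :
      Reaches σ v w (d + 1) s' (k + 1)

namespace Reaches

variable {ι σ τ : Type} {v w u : σ → QV ι} {d s k d' s' k' : ℕ}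

theorem mono (h : Reaches σ v w d s k) (hd : d ≤ d') (hs : s ≤ s') (hk : k ≤ k') :
    Reaches σ v w d' s' k' := by
  induction h generalizing d' s' k' with
  | done σ v w d s k h => exact .done _ _ _ _ _ _ h
  | single σ v w d s s₁ k T q hq U hs₁ h ih =>
    obtain ⟨e, rfl⟩ : ∃ e, d' = e + 1 := ⟨d' - 1, by omega⟩
    exact .single _ _ _ _ s _ _ T q hq U (by omega) (ih (by omega) le_rfl hk)
  | cnot σ v w d s s₁ k T c t hc ht hct hs₁ h ih =>
    obtain ⟨e, rfl⟩ : ∃ e, d' = e + 1 := ⟨d' - 1, by omega⟩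
    exact .cnot _ _ _ _ s _ _ T c t hc ht hct (by omega) (ih (by omega) le_rfl hk)
  | measure σ v w d s s₁ k T q hq hs₁ h ih =>
    obtain ⟨e, rfl⟩ : ∃ e, d' = e + 1 := ⟨d' - 1, by omega⟩
    obtain ⟨l, rfl⟩ : ∃ l, k' = l + 1 := ⟨k' - 1, by omega⟩
    exact .measure _ _ _ _ s _ _ T q hq (by omega) (ih (by omega) le_rfl (by omega))

/-- A circuit may ignore classical information. Composition after a measurement relies on this: the
second circuit knows nothing of the outcomes of the first. -/
theorem comp (h : Reaches σ v w d s k) (f : τ → σ) : Reaches τ (v ∘ f) (w ∘ f) d s k := by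
  induction h generalizing τ with
  | done σ v w d s k h => exact .done _ _ _ _ _ _ fun p => h (f p)
  | single σ v w d s s₁ k T q hq U hs₁ h ih =>
    exact .single _ _ _ _ s _ _ T q hq (U ∘ f) hs₁ (ih f)
  | cnot σ v w d s s₁ k T c t hc ht hct hs₁ h ih =>
    exact .cnot _ _ _ _ s _ _ T c t hc ht hct hs₁ (ih f)
  | measure σ v w d s s₁ k T q hq hs₁ h ih =>
    exact .measure _ _ _ _ s _ _ T q hq hs₁ (ih (Prod.map f id))

/-- All operations are linear and states are not normalized. This absorbs the branch-dependent
scalar left by `done` when two circuits are joined in `trans`. -/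
theorem smul (h : Reaches σ v w d s k) (a : σ → ℂ) :
    Reaches σ (fun p => a p • v p) w d s k := by
  induction h with
  | done σ v w d s k h =>
    refine .done _ _ _ _ _ _ fun p => ?_
    obtain ⟨b, hb⟩ := h p
    exact ⟨a p * b, by rw [hb, smul_smul]⟩
  | single σ v w d s s₁ k T q hq U hs₁ h ih =>
    refine .single _ _ _ _ s _ _ T q hq U hs₁ ?_
    simpa only [parOp_smul] using ih a
  | cnot σ v w d s s₁ k T c t hc ht hct hs₁ h ih =>
    exact .cnot _ _ _ _ s _ _ T c t hc ht hct hs₁ (ih a)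
  | measure σ v w d s s₁ k T q hq hs₁ h ih =>
    refine .measure _ _ _ _ s _ _ T q hq hs₁ ?_
    convert ih (fun p => a p.1) using 3 with p x
    simp only [Pi.smul_apply, smul_eq_mul]
    ring

theorem trans (h : Reaches σ v w d s k) (h' : Reaches σ w u d' s' k') :
    Reaches σ v u (d + d') (s + s') (k + k') := by
  induction h with
  | done σ v w d s k h =>
    choose a ha using h
    rw [show v = fun p => a p • w p from funext ha]
    exact (h'.smul a).mono (by omega) (by omega) (by omega)
  | single σ v w d s s₁ k T q hq U hs₁ h ih =>
    exact (single _ _ _ _ (s + s') _ _ T q hq U le_rfl (ih h')).mono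
      (by omega) (by omega) (by omega)
  | cnot σ v w d s s₁ k T c t hc ht hct hs₁ h ih =>
    exact (cnot _ _ _ _ (s + s') _ _ T c t hc ht hct le_rfl (ih h')).mono
      (by omega) (by omega) (by omega)
  | measure σ v w d s s₁ k T q hq hs₁ h ih =>
    exact (measure _ _ _ _ (s + s') _ _ T q hq le_rfl (ih (h'.comp Prod.fst))).mono
      (by omega) (by omega) (by omega)

end Reaches

/-! ### Idle wires in the state zero -/

/-- The vector `v` on the wires in the range of `e`, with all other wires in the state `|0⟩`. -/
noncomputable def embedVec {ι κ : Type} (e : ι → κ) (v : QV ι) : QV κ := fun x =>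
  ind (∀ i, (∀ j, e j ≠ i) → x i = 0) * v (x ∘ e)

section Embed

variable {ι κ T : Type} {e : ι → κ}

theorem extend_embed (he : Injective e) (q : T → ι) (hq : Injective q) (b : T → Bool)
    (x : κ → Bool) : extend (e ∘ q) b x ∘ e = extend q b (x ∘ e) := by
  funext i
  by_cases h : ∃ t, q t = i
  · obtain ⟨t, rfl⟩ := h
    rw [hq.extend_apply]
    exact (he.comp hq).extend_apply _ _ _
  · rw [extend_apply' _ _ _ h, comp_apply, extend_apply', comp_apply]
    rintro ⟨t, ht⟩
    exact h ⟨t, he ht⟩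

theorem embedVec_extend (he : Injective e) (q : T → ι) (hq : Injective q) (b : T → Bool)
    (v : QV ι) (x : κ → Bool) :
    embedVec e v (extend (e ∘ q) b x) =
      ind (∀ i, (∀ j, e j ≠ i) → x i = 0) * v (extend q b (x ∘ e)) := by
  rw [embedVec, extend_embed he q hq]
  congr 2
  refine propext (forall_congr' fun i => forall_congr' fun hi => ?_)
  rw [extend_apply']
  rintro ⟨t, ht⟩
  exact hi _ ht

theorem parOp_embedVec [Fintype T] [DecidableEq T] (he : Injective e) (q : T → ι) (hq : Injective q)
    (U : T → Matrix Bool Bool ℂ) (v : QV ι) :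
    parOp (e ∘ q) U (embedVec e v) = embedVec e (parOp q U v) := by
  funext x
  simp only [parOp, embedVec_extend he q hq]
  simp only [embedVec, comp_apply]
  rw [parOp, Finset.mul_sum]
  exact Finset.sum_congr rfl fun b _ => by simp only [comp_apply]; ring

theorem cnotOp_embedVec (he : Injective e) (c t : T → ι) (ht : Injective t) (v : QV ι) :
    cnotOp (e ∘ c) (e ∘ t) (embedVec e v) = embedVec e (cnotOp c t v) := by
  funext x
  simp only [cnotOp, embedVec_extend he t ht]
  rfl

theorem Reaches.embed {σ : Type} {v w : σ → QV ι} {d s k : ℕ} (h : Reaches σ v w d s k)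
    (he : Injective e) :
    Reaches σ (fun p => embedVec e (v p)) (fun p => embedVec e (w p)) d s k := by
  induction h with
  | done σ v w d s k h =>
    refine .done _ _ _ _ _ _ fun p => ?_
    obtain ⟨b, hb⟩ := h p
    refine ⟨b, funext fun x => ?_⟩
    simp only [hb, embedVec, Pi.smul_apply, smul_eq_mul]
    ring
  | single σ v w d s s₁ k T q hq U hs₁ h ih =>
    refine .single _ _ _ _ s _ _ T (e ∘ q) (he.comp hq) U hs₁ ?_
    simpa only [parOp_embedVec he q hq] using ih
  | cnot σ v w d s s₁ k T c t hc ht hct hs₁ h ih =>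
    refine .cnot _ _ _ _ s _ _ T (e ∘ c) (e ∘ t) (he.comp hc) (he.comp ht)
      (fun a b hab => hct a b (he hab)) hs₁ ?_
    simpa only [cnotOp_embedVec he c t ht] using ih
  | measure σ v w d s s₁ k T q hq hs₁ h ih =>
    refine .measure _ _ _ _ s _ _ T (e ∘ q) (he.comp hq) hs₁ ?_
    convert ih using 3 with p x
    simp only [embedVec, comp_apply]
    ring

end Embed

/-! ### From reachability to actual circuits -/

section Soundness

variable {m : ℕ} {T : Type}

/-- One gate is a full parallel layer with identities on the other wires, so executing the gates of
a layer one after another becomes wirewise multiplication by `parOp_parOp`. -/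
theorem single_apply_eq_parOp [Fintype T] [DecidableEq T] {q : T → Fin m} (hq : Injective q) (t : T)
    (U : Record m → Matrix.unitaryGroup Bool ℂ) (r : Record m) (v : QVec m) :
    (Gate.single (q t) U).apply r v =
      parOp q (fun a => if a = t then (U r : Matrix Bool Bool ℂ) else 1) v := by
  funext x
  simp only [Gate.apply, parOp]
  refine Fintype.sum_of_injective (fun c => update (fun a => x (q a)) t c)
    (fun c c' h => by simpa using congrFun h t) _ _ (fun b hb => ?_) fun c => ?_
  · obtain ⟨a, hat, ha⟩ : ∃ a, a ≠ t ∧ b a ≠ x (q a) := by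
      by_contra! h
      refine hb ⟨b t, funext fun a => ?_⟩
      by_cases hat : a = t
      · subst hat; simp
      · simp [hat, h a hat]
    rw [Finset.prod_eq_zero (Finset.mem_univ a), zero_mul]
    simp [hat, ha.symm]
  · rw [Fintype.prod_eq_single t]
    · congr 2
      · simp
      · funext i
        by_cases h : ∃ a, q a = i
        · obtain ⟨a, rfl⟩ := h
          rw [hq.extend_apply]
          by_cases hat : a = t
          · subst hat; simp
          · simp [hat, hq.ne hat]
        · rw [extend_apply' _ _ _ h, update_of_ne]
          rintro rfl
          exact h ⟨t, rfl⟩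
    · intro a hat
      rw [if_neg hat, show update (fun a => x (q a)) t c a = x (q a) from update_of_ne hat _ _,
        Matrix.one_apply_eq]

theorem foldl_single [Fintype T] [DecidableEq T] {q : T → Fin m} (hq : Injective q)
    (U : T → Record m → Matrix.unitaryGroup Bool ℂ) (r : Record m) (l : List T) (hl : l.Nodup)
    (v : QVec m) :
    (l.map fun t => Gate.single (q t) (U t)).foldl (fun w g => g.apply r w) v =
      parOp q (fun t => if t ∈ l then (U t r : Matrix Bool Bool ℂ) else 1) v := by
  induction l generalizing v with
  | nil => simp [parOp_one]
  | cons t l ih =>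
    rw [List.nodup_cons] at hl
    rw [List.map_cons, List.foldl_cons, ih hl.2, single_apply_eq_parOp hq, parOp_parOp hq]
    congr 1
    funext a
    by_cases hat : a = t
    · subst hat; simp [hl.1]
    · simp [hat]

theorem foldl_cnot [DecidableEq T] {c t : T → Fin m} (ht : Injective t)
    (hct : ∀ a b, c a ≠ t b) (r : Record m) (l : List T) (hl : l.Nodup) (v : QVec m) :
    (l.map fun a => Gate.cnot (c a) (t a) (hct a a)).foldl (fun w g => g.apply r w) v =
      fun x => v (extend t (fun a => if a ∈ l then x (t a) + x (c a) else x (t a)) x) := by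
  induction l generalizing v with
  | nil => simp [extend_self]
  | cons a l ih =>
    rw [List.nodup_cons] at hl
    rw [List.map_cons, List.foldl_cons, ih hl.2]
    funext x
    simp only [Gate.apply]
    congr 1
    funext i
    by_cases h : ∃ b, t b = i
    · obtain ⟨b, rfl⟩ := h
      by_cases hba : b = a
      · subst hba
        rw [update_self, ht.extend_apply, ht.extend_apply, extend_apply' _ _ (c b)]
        · simp [hl.1]; rfl
        · rintro ⟨b', hb'⟩
          exact hct b b' hb'.symm
      · rw [update_of_ne (ht.ne hba), ht.extend_apply, ht.extend_apply]
        simp [hba]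
    · rw [update_of_ne, extend_apply' _ _ _ h, extend_apply' _ _ _ h]
      rintro rfl
      exact h ⟨a, rfl⟩

/-- The function `g` decodes the classical information from the record, so that a choice depending
on `σ` becomes a gate depending on the record, as feedback allows. -/
theorem Reaches.exists_circuit {σ : Type} {v w : σ → QVec m} {d s k : ℕ}
    (h : Reaches σ v w d s k) (g : Record m → σ) :
    ∃ C : Circuit m, C.depth ≤ d ∧ C.size ≤ s ∧ C.measureLayers ≤ k ∧
      ∀ (o : ℕ → Fin m → Bool) (r : Record m),
        ∃ a : ℂ, Circuit.runFrom o C r (v (g r)) = a • w (g r) := by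
  induction h with
  | done σ v w d s k h =>
    exact ⟨[], by simp [Circuit.depth], by simp [Circuit.size], by simp [Circuit.measureLayers],
      fun o r => h (g r)⟩
  | single σ v w d s s₁ k T q hq U hs₁ h ih =>
    obtain ⟨C, hd, hs, hk, hC⟩ := ih g
    let l := (Finset.univ : Finset T).toList
    refine ⟨Layer.gates (l.map fun t => Gate.single (q t) fun r => U (g r) t) ?_ :: C, ?_, ?_, ?_,
      fun o r => ?_⟩
    · rw [List.pairwise_map]
      refine (Finset.nodup_toList _).imp fun {a b} hab => ?_
      simpa [Gate.support] using hq.ne hab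
    · simpa [Circuit.depth] using hd
    · simp only [Circuit.size, List.map_cons, List.sum_cons, Layer.size, List.length_map] at hs ⊢
      simp only [l, Finset.length_toList, Finset.card_univ]
      omega
    · simpa [Circuit.measureLayers, Layer.isMeasure] using hk
    · rw [Circuit.runFrom, foldl_single hq (fun t r => U (g r) t) _ _ (Finset.nodup_toList _)]
      simpa [l] using hC o r
  | cnot σ v w d s s₁ k T c t hc ht hct hs₁ h ih =>
    obtain ⟨C, hd, hs, hk, hC⟩ := ih g
    let l := (Finset.univ : Finset T).toList
    refine ⟨Layer.gates (l.map fun a => Gate.cnot (c a) (t a) (hct a a)) ?_ :: C, ?_, ?_, ?_,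
      fun o r => ?_⟩
    · rw [List.pairwise_map]
      refine (Finset.nodup_toList _).imp fun {a b} hab => ?_
      simp [Gate.support, (hc.ne hab).symm, (ht.ne hab).symm, hct, (hct a b).symm]
    · simpa [Circuit.depth] using hd
    · simp only [Circuit.size, List.map_cons, List.sum_cons, Layer.size, List.length_map] at hs ⊢
      simp only [l, Finset.length_toList, Finset.card_univ]
      omega
    · simpa [Circuit.measureLayers, Layer.isMeasure] using hk
    · rw [Circuit.runFrom, foldl_cnot ht hct _ _ (Finset.nodup_toList _)]
      simpa [l] using! hC o r
  | measure σ v w d s s₁ k T q hq hs₁ h ih =>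
    -- After a measurement the record is one entry longer: the old information is decoded from all
    -- but the last entry, the new outcomes are read off the last one.
    obtain ⟨C, hd, hs, hk, hC⟩ := ih fun r =>
      (g r.dropLast, fun t => r.getLastD (fun _ => false) (q t))
    refine ⟨Layer.measure (Finset.univ.image q) :: C, ?_, ?_, ?_, fun o r => ?_⟩
    · simpa [Circuit.depth] using hd
    · simp only [Circuit.size, List.map_cons, List.sum_cons, Layer.size] at hs ⊢
      rw [Finset.card_image_of_injective _ hq, Finset.card_univ]
      omega
    · rw [Circuit.measureLayers, List.countP_cons]
      exact Nat.add_le_add hk (by simp [Layer.isMeasure])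
    · rw [Circuit.runFrom]
      obtain ⟨a, ha⟩ := hC o
        (r ++ [fun i => if i ∈ Finset.univ.image q then o r.length i else false])
      refine ⟨a, ?_⟩
      simp only [List.dropLast_concat, List.getLastD_concat] at ha
      rw [← ha]
      congr 1
      funext x
      simp [project, ind]

end Soundness

/-! ### Bookkeeping of ancillas -/

/-- The bijection of the wires of a register with `A` as index type of the ancillas. -/
noncomputable def wireEquiv (n : ℕ) (A : Type) [Fintype A] : Fin n ⊕ A ≃ Fin (n + Fintype.card A) :=
  (Equiv.sumCongr (Equiv.refl _) (Fintype.equivFin A)).trans finSumFinEquiv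

theorem embedVec_wireEquiv (n : ℕ) (A : Type) [Fintype A] (ψ : QVec n) :
    embedVec (wireEquiv n A) (embedVec Sum.inl ψ) = withZeros (Fintype.card A) ψ := by
  funext x
  have h1 : ind (∀ i, (∀ j, wireEquiv n A j ≠ i) → x i = 0) = 1 :=
    ind_true fun i hi => absurd ((wireEquiv n A).apply_symm_apply i) (hi _)
  rw [embedVec, h1, one_mul, embedVec, withZeros, ind]
  have h2 : (∀ i : Fin n ⊕ A, (∀ j : Fin n, Sum.inl j ≠ i) → (x ∘ wireEquiv n A) i = 0) ↔
      ∀ k : Fin (Fintype.card A), x (Fin.natAdd n k) = false := by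
    constructor
    · intro h k
      have := h (Sum.inr ((Fintype.equivFin A).symm k)) (by simp)
      simpa [wireEquiv, Bool.zero_eq_false] using this
    · rintro h (i | i) hi
      · exact absurd rfl (hi i)
      · simpa [wireEquiv, Bool.zero_eq_false] using h (Fintype.equivFin A i)
  simp only [h2]
  split_ifs
  · rw [one_mul]
    congr 1
  · rw [zero_mul]

theorem embedVec_embedVec {ι κ μ : Type} {f : ι → κ} {e : κ → μ} (he : Injective e) (v : QV ι) :
    embedVec e (embedVec f v) = embedVec (e ∘ f) v := by
  funext x
  rw [embedVec, embedVec, embedVec, ← mul_assoc, ← ind_and]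
  congr 2
  refine propext ⟨fun ⟨h₁, h₂⟩ i hi => ?_, fun h => ⟨fun i hi => h i fun j => hi _, fun i hi => ?_⟩⟩
  · by_cases h : ∃ j, e j = i
    · obtain ⟨j, rfl⟩ := h
      exact h₂ j fun l hl => hi l (congrArg e hl)
    · exact h₁ i fun j hj => h ⟨j, hj⟩
  · exact h (e i) fun j hj => hi j (he hj)

theorem embedVec_inl {ι A : Type} (v : QV ι) (x : ι ⊕ A → Bool) :
    embedVec (Sum.inl : ι → ι ⊕ A) v x = ind (∀ a, x (Sum.inr a) = 0) * v (x ∘ Sum.inl) := by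
  rw [embedVec]
  congr 2
  refine propext ⟨fun h a => h _ (by simp), ?_⟩
  rintro h (i | a) hi
  · exact absurd rfl (hi i)
  · exact h a

/-- `Prep v w d s k a`: there is a circuit of depth at most `d`, size at most `s` and at most `k`
measurement layers that prepares `w` from `v` with the help of at most `a` ancillas. -/
def Prep {ι : Type} (v w : QV ι) (d s k a : ℕ) : Prop :=
  ∃ (A : Type) (_ : Fintype A), Fintype.card A ≤ a ∧
    Reaches Unit (fun _ => embedVec (Sum.inl : ι → ι ⊕ A) v)
      (fun _ => embedVec (Sum.inl : ι → ι ⊕ A) w) d s k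

namespace Prep

variable {ι : Type} {v w u : QV ι} {d s k a d' s' k' a' : ℕ}

theorem mono (h : Prep v w d s k a) (hd : d ≤ d') (hs : s ≤ s') (hk : k ≤ k') (ha : a ≤ a') :
    Prep v w d' s' k' a' := by
  obtain ⟨A, _, hA, h⟩ := h
  exact ⟨A, _, hA.trans ha, h.mono hd hs hk⟩

theorem trans (h : Prep v w d s k a) (h' : Prep w u d' s' k' a') :
    Prep v u (d + d') (s + s') (k + k') (a + a') := by
  obtain ⟨A, _, hA, h⟩ := h
  obtain ⟨A', _, hA', h'⟩ := h'
  refine ⟨A ⊕ A', inferInstance, by rw [Fintype.card_sum]; omega, ?_⟩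
  have i₁ : Injective (Sum.map id Sum.inl : ι ⊕ A → ι ⊕ (A ⊕ A')) :=
    injective_id.sumMap Sum.inl_injective
  have i₂ : Injective (Sum.map id Sum.inr : ι ⊕ A' → ι ⊕ (A ⊕ A')) :=
    injective_id.sumMap Sum.inr_injective
  have h₁ := h.embed i₁
  have h₂ := h'.embed i₂
  simp only [embedVec_embedVec i₁] at h₁
  simp only [embedVec_embedVec i₂] at h₂
  exact h₁.trans h₂

/-- A work register that starts and ends in zero is just a set of ancillas, so it can be introduced
locally and charged to the ancilla count. -/
theorem alloc {T : Type} [Fintype T]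
    (h : Prep (embedVec (Sum.inl : ι → ι ⊕ T) v) (embedVec Sum.inl w) d s k a) :
    Prep v w d s k (Fintype.card T + a) := by
  obtain ⟨A, _, hA, h⟩ := h
  refine ⟨T ⊕ A, inferInstance, by rw [Fintype.card_sum]; omega, ?_⟩
  have h := h.embed (Equiv.sumAssoc ι T A).injective
  simp only [embedVec_embedVec (Equiv.sumAssoc ι T A).injective,
    embedVec_embedVec (Sum.inl_injective : Injective (Sum.inl : ι ⊕ T → (ι ⊕ T) ⊕ A))] at h
  exact h

theorem ofReaches (h : Reaches Unit (fun _ => v) (fun _ => w) d s k) : Prep v w d s k 0 :=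
  ⟨Empty, inferInstance, by simp, h.embed Sum.inl_injective⟩

theorem ofReachesPadded {A : Type} [Fintype A]
    (h : Reaches Unit (fun _ => embedVec (Sum.inl : ι → ι ⊕ A) v)
      (fun _ => embedVec (Sum.inl : ι → ι ⊕ A) w) d s k) : Prep v w d s k (Fintype.card A) :=
  ⟨A, inferInstance, le_rfl, h⟩

theorem parOp {T : Type} [Fintype T] [DecidableEq T] {q : T → ι} (hq : Injective q)
    (U : T → Matrix.unitaryGroup Bool ℂ) (v : QV ι) :
    Prep v (parOp q (fun t => (U t : Matrix Bool Bool ℂ)) v) 1 (Fintype.card T) 0 0 :=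
  ofReaches (.single _ _ _ 0 0 _ _ T q hq (fun _ => U) le_rfl
    (.done _ _ _ _ _ _ fun _ => ⟨1, (one_smul _ _).symm⟩))

theorem cnotOp {T : Type} [Fintype T] [DecidableEq T] {c t : T → ι} (hc : Injective c)
    (ht : Injective t) (hct : ∀ a b, c a ≠ t b) (v : QV ι) :
    Prep v (cnotOp c t v) 1 (Fintype.card T) 0 0 :=
  ofReaches (.cnot _ _ _ 0 0 _ _ T c t hc ht hct le_rfl
    (.done _ _ _ _ _ _ fun _ => ⟨1, (one_smul _ _).symm⟩))

theorem exists_circuit {n : ℕ} {ψ : QVec n} (h : Prep (ket fun _ => false) ψ d s k a) :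
    ∃ (b : ℕ) (C : Circuit (n + b)), C.Prepares ψ ∧ C.depth ≤ d ∧ C.size ≤ s ∧ b ≤ a ∧
      C.measureLayers ≤ k := by
  obtain ⟨A, _, hA, h⟩ := h
  have h := h.embed (wireEquiv n A).injective
  simp only [embedVec_wireEquiv] at h
  obtain ⟨C, hd, hs, hk, hC⟩ := h.exists_circuit fun _ => ()
  refine ⟨_, C, fun o => ?_, hd, hs, hA, hk⟩
  obtain ⟨c, hc⟩ := hC o []
  refine ⟨c, ?_⟩
  rw [← hc, Circuit.run]
  congr 1
  funext x
  simp only [withZeros, ket, Pi.single_apply]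
  by_cases hx : x = fun _ => false
  · subst hx
    simp
  · rw [if_neg hx]
    split_ifs with h₁ h₂
    · refine absurd (funext fun i => ?_) hx
      induction i using Fin.addCases with
      | left i => exact congrFun h₂ i
      | right i => exact h₁ i
    · rfl
    · rfl

end Prep

namespace Reaches

variable {ι σ : Type} {v w : σ → QV ι} {d s k s' : ℕ}

theorem single_of_eq (v' : σ → QV ι) {T : Type} [Fintype T] [DecidableEq T]
    {q : T → ι} (hq : Injective q) (U : σ → T → Matrix.unitaryGroup Bool ℂ)
    (hv : ∀ p x, parOp q (fun t => (U p t : Matrix Bool Bool ℂ)) (v p) x = v' p x)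
    (h : Reaches σ v' w d s k) : Reaches σ v w (d + 1) (Fintype.card T + s) k := by
  refine .single _ _ _ _ s _ _ T q hq U le_rfl ?_
  rwa [show (fun p => parOp q (fun t => (U p t : Matrix Bool Bool ℂ)) (v p)) = v' from
    funext fun p => funext (hv p)]

theorem cnot_of_eq (v' : σ → QV ι) {T : Type} [Fintype T] [DecidableEq T]
    {c t : T → ι} (hc : Injective c) (ht : Injective t) (hct : ∀ a b, c a ≠ t b)
    (hv : ∀ p x, cnotOp c t (v p) x = v' p x)
    (h : Reaches σ v' w d s k) : Reaches σ v w (d + 1) (Fintype.card T + s) k := by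
  refine .cnot _ _ _ _ s _ _ T c t hc ht hct le_rfl ?_
  rwa [show (fun p => cnotOp c t (v p)) = v' from funext fun p => funext (hv p)]

/-- A control `none` stands for an absent gate. Parity constraints with fewer than the maximal
number of terms can thus be written by one uniform layer. -/
theorem cnot_option_of_eq (v' : σ → QV ι) {T : Type} [Fintype T] [DecidableEq T]
    {c : T → Option ι} {t : T → ι} (hc : ∀ a b i, c a = some i → c b = some i → a = b)
    (ht : Injective t) (hct : ∀ a b, c a ≠ some (t b))
    (hv : ∀ p x, v p (extend t (fun a => x (t a) + (c a).elim 0 x) x) = v' p x)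
    (h : Reaches σ v' w d s k) : Reaches σ v w (d + 1) (Fintype.card T + s) k := by
  refine mono (cnot_of_eq v' (T := {a // (c a).isSome}) (c := fun a => (c a).get a.2)
    (t := fun a => t a) ?_ ?_ ?_ (fun p x => ?_) h) le_rfl
    (Nat.add_le_add_right (Fintype.card_subtype_le _) _) le_rfl
  · rintro ⟨a, ha⟩ ⟨b, hb⟩ hab
    simp only at hab
    exact Subtype.ext (hc a b ((c a).get ha) (by simp) (by rw [hab]; simp))
  · exact ht.comp Subtype.val_injective
  · rintro ⟨a, ha⟩ b hab
    exact hct a b (by rw [← hab]; simp)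
  · rw [← hv, cnotOp]
    congr 1
    funext i
    by_cases hi : ∃ a, t a = i
    · obtain ⟨a, rfl⟩ := hi
      rw [ht.extend_apply]
      by_cases ha : (c a).isSome
      · have := (ht.comp Subtype.val_injective).extend_apply
          (fun b : {a // (c a).isSome} => x (t b) + x ((c b).get b.2)) x ⟨a, ha⟩
        refine this.trans ?_
        obtain ⟨i, hi⟩ := Option.isSome_iff_exists.1 ha
        simp [hi]
      · rw [extend_apply']
        · rw [Option.not_isSome_iff_eq_none.1 ha]
          exact (add_zero _).symm
        · rintro ⟨⟨b, hb⟩, hba⟩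
          exact ha (ht hba ▸ hb)
    · rw [extend_apply' _ _ _ hi, extend_apply']
      rintro ⟨b, hb⟩
      exact hi ⟨b, hb⟩

end Reaches

/-! ### Signs and elementary gates -/

section Sign

/-- The sign `(-1)^b`. -/
def sgn {R : Type} [CommRing R] (b : Bool) : R := if b then -1 else 1

variable {R : Type} [CommRing R]

@[simp] theorem sgn_zero : (sgn 0 : R) = 1 := rfl

@[simp] theorem sgn_false : (sgn false : R) = 1 := rfl

@[simp] theorem sgn_true : (sgn true : R) = -1 := rfl

theorem sgn_add (a b : Bool) : (sgn (a + b) : R) = sgn a * sgn b := by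
  rw [show a + b = xor a b from rfl]
  cases a <;> cases b <;> simp

theorem sgn_sum {I : Type} (s : Finset I) (f : I → Bool) :
    (sgn (∑ i ∈ s, f i) : R) = ∏ i ∈ s, sgn (f i) := by
  classical
  induction s using Finset.induction_on with
  | empty => simp
  | insert a s ha ih => rw [Finset.sum_insert ha, Finset.prod_insert ha, sgn_add, ih]

end Sign

theorem bool_add_self (a : Bool) : a + a = 0 := BooleanRing.add_self a

theorem bool_add_eq_zero {a b : Bool} : a + b = 0 ↔ a = b := by
  rw [show a + b = xor a b from rfl]
  cases a <;> cases b <;> decide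

theorem bool_add_eq_right {a b : Bool} : a + b = b ↔ a = 0 := by
  rw [show a + b = xor a b from rfl]
  cases a <;> cases b <;> decide

/-- The normalization `1/√2` of the Hadamard gate. -/
noncomputable def hadamardScale : ℂ := ((√2)⁻¹ : ℝ)

theorem hadamardScale_sq : hadamardScale * hadamardScale = 1 / 2 := by
  rw [hadamardScale, ← Complex.ofReal_mul, ← mul_inv, Real.mul_self_sqrt (by norm_num)]
  norm_num

/-- The Hadamard matrix. -/
noncomputable def hadamardMatrix : Matrix Bool Bool ℂ := fun i j => hadamardScale * sgn (i * j)

/-- The Hadamard gate. -/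
noncomputable def hadamard : Matrix.unitaryGroup Bool ℂ :=
  ⟨hadamardMatrix, by
    rw [Matrix.mem_unitaryGroup_iff]
    ext i j
    have h := hadamardScale_sq
    have hc : (starRingEnd ℂ) hadamardScale = hadamardScale := Complex.conj_ofReal _
    rw [Matrix.mul_apply, Fintype.sum_bool]
    simp only [hadamardMatrix, Matrix.star_apply, RCLike.star_def, map_mul, hc]
    have e1 : (true * true : Bool) = true := rfl
    have e2 : (true * false : Bool) = false := rfl
    have e3 : (false * true : Bool) = false := rfl
    have e4 : (false * false : Bool) = false := rfl
    cases i <;> cases j <;> simp [e1, e2, e3, e4] <;> linear_combination 2 * h⟩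

theorem hadamard_apply (i j : Bool) :
    (hadamard : Matrix Bool Bool ℂ) i j = hadamardScale * sgn (i * j) := rfl

/-- The gate `X^b`. -/
noncomputable def flip (b : Bool) : Matrix.unitaryGroup Bool ℂ :=
  ⟨flipMatrix b, by
    rw [Matrix.mem_unitaryGroup_iff]
    ext i j
    rw [Matrix.mul_apply, Fintype.sum_bool]
    simp only [Matrix.star_apply, flipMatrix, show ∀ a c : Bool, a + c = xor a c from fun _ _ => rfl]
    cases i <;> cases j <;> cases b <;> simp⟩

@[simp] theorem coe_flip (b : Bool) : (flip b : Matrix Bool Bool ℂ) = flipMatrix b := rfl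

/-- The gate with diagonal entries `exp (i φ b)`. -/
noncomputable def phase (φ : Bool → ℝ) : Matrix.unitaryGroup Bool ℂ :=
  ⟨Matrix.diagonal fun b => Complex.exp (φ b * Complex.I), by
    rw [Matrix.mem_unitaryGroup_iff, Matrix.star_eq_conjTranspose, Matrix.diagonal_conjTranspose,
      Matrix.diagonal_mul_diagonal, ← Matrix.diagonal_one]
    congr 1
    funext b
    rw [Pi.star_apply, RCLike.star_def, ← Complex.exp_conj, ← Complex.exp_add]
    simp⟩

theorem coe_phase (φ : Bool → ℝ) : (phase φ : Matrix Bool Bool ℂ) =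
    Matrix.diagonal fun b => Complex.exp (φ b * Complex.I) := rfl

/-- The phase of the sign `(-1)^b`. -/
noncomputable def signPhase (b : Bool) : ℝ := if b then Real.pi else 0

theorem exp_signPhase (b : Bool) : Complex.exp (signPhase b * Complex.I) = sgn b := by
  cases b <;> simp [signPhase]

/-- The gate `Z^b`. -/
noncomputable def signFlip (b : Bool) : Matrix.unitaryGroup Bool ℂ :=
  phase fun i => signPhase (b * i)

theorem coe_signFlip (b : Bool) :
    (signFlip b : Matrix Bool Bool ℂ) = Matrix.diagonal fun i => sgn (b * i) := by
  rw [signFlip, coe_phase]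
  congr 1
  exact funext fun i => exp_signPhase _

/-! ### Linear maps by measuring parity constraints -/

section Linear

variable {ι K : Type}

/-- The parity constraint `k`, involving the variable `k` and at most two further ones. -/
def constraint (src₁ src₂ : K → Option (ι ⊕ K)) (z : ι ⊕ K → Bool) (k : K) : Bool :=
  z (Sum.inr k) + (src₁ k).elim 0 z + (src₂ k).elim 0 z

theorem constraint_add (src₁ src₂ : K → Option (ι ⊕ K)) (z z' : ι ⊕ K → Bool) (k : K) :
    constraint src₁ src₂ (z + z') k = constraint src₁ src₂ z k + constraint src₁ src₂ z' k := by
  unfold constraint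
  rcases src₁ k with _ | i <;> rcases src₂ k with _ | j <;>
    simp only [Option.elim, Pi.add_apply] <;> ring

theorem extend_middle (b : K → Bool) (x : ι ⊕ (K ⊕ K) → Bool) :
    extend (fun k => (Sum.inr (Sum.inl k) : ι ⊕ (K ⊕ K))) b x =
      Sum.elim (x ∘ Sum.inl) (Sum.elim b (x ∘ Sum.inr ∘ Sum.inr)) := by
  funext i
  rcases i with i | i | i
  · rw [extend_apply' _ _ _ (by simp)]; rfl
  · exact Injective.extend_apply (fun a b h => by simpa using h) _ _ _
  · rw [extend_apply' _ _ _ (by simp)]; rfl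

theorem extend_right (b : K → Bool) (x : ι ⊕ (K ⊕ K) → Bool) :
    extend (fun k => (Sum.inr (Sum.inr k) : ι ⊕ (K ⊕ K))) b x =
      Sum.elim (x ∘ Sum.inl) (Sum.elim (x ∘ Sum.inr ∘ Sum.inl) b) := by
  funext i
  rcases i with i | i | i
  · rw [extend_apply' _ _ _ (by simp)]; rfl
  · rw [extend_apply' _ _ _ (by simp)]; rfl
  · exact Injective.extend_apply (fun a b h => by simpa using h) _ _ _

theorem extend_inl {T A : Type} {q : T → ι} (hq : Injective q) (b : T → Bool) (x : ι ⊕ A → Bool) :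
    extend (fun t => (Sum.inl (q t) : ι ⊕ A)) b x =
      Sum.elim (extend q b (x ∘ Sum.inl)) (x ∘ Sum.inr) := by
  funext i
  rcases i with i | i
  · exact congrFun (extend_embed (e := (Sum.inl : ι → ι ⊕ A)) Sum.inl_injective q hq b x) i
  · rw [extend_apply' _ _ _ (by simp)]; rfl

theorem extend_inr {A : Type} (b : A → Bool) (x : ι ⊕ A → Bool) :
    extend (Sum.inr : A → ι ⊕ A) b x = Sum.elim (x ∘ Sum.inl) b := by
  funext i
  rcases i with i | i
  · rw [extend_apply' _ _ _ (by simp)]; rfl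
  · exact Sum.inr_injective.extend_apply _ _ _

variable {L J : Type} [Fintype K] [DecidableEq K] [Fintype L] [DecidableEq L]
  [Fintype J] [DecidableEq J]

/-- The Boolean-linear map with matrix `M`. -/
def linMap (M : K → L → Bool) (y : L → Bool) (k : K) : Bool := ∑ l, M k l * y l

/-- The wires of the variables of a linear system. -/
def varWire : ι ⊕ K → ι ⊕ (K ⊕ K) := Sum.map id Sum.inl

/-- Adding a Boolean-linear function `M` of the wires `inp` to the wires `out`, when `M` is computed
by a sparse system of parity constraints. -/
theorem Prep.linear_of_constraints (v : QV ι) (inp : L → ι) (out : J → ι) (sel : J → K)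
    (hinp : Injective inp) (hout : Injective out) (hsel : Injective sel)
    (hio : ∀ l j, inp l ≠ out j) (M : K → L → Bool) (src₁ src₂ : K → Option (ι ⊕ K))
    (h₁ : ∀ a b i, src₁ a = some i → src₁ b = some i → a = b)
    (h₂ : ∀ a b i, src₂ a = some i → src₂ b = some i → a = b)
    (hsurj : ∀ m : K → Bool, ∃ b : K → Bool, ∀ k, constraint src₁ src₂ (Sum.elim 0 b) k = m k)
    (hM : ∀ z, (∀ k, constraint src₁ src₂ z k = 0) ↔
      ∀ k, z (Sum.inr k) = linMap M (fun l => z (Sum.inl (inp l))) k) :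
    Prep v (fun y => v (extend out (fun j => y (out j) + linMap M (fun l => y (inp l)) (sel j)) y))
      11 (10 * Fintype.card K + Fintype.card J + Fintype.card L) 2 (2 * Fintype.card K) := by
  choose b hb using hsurj
  set w : QV ι := fun y =>
    v (extend out (fun j => y (out j) + linMap M (fun l => y (inp l)) (sel j)) y) with hw
  have iP : Injective (fun k => (Sum.inr (Sum.inl k) : ι ⊕ (K ⊕ K))) := fun a b h => by simpa using h
  have iC : Injective (fun k => (Sum.inr (Sum.inr k) : ι ⊕ (K ⊕ K))) := fun a b h => by simpa using h
  have iV : Injective (varWire : ι ⊕ K → ι ⊕ (K ⊕ K)) :=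
    injective_id.sumMap Sum.inl_injective
  have hV : ∀ (a : K → Bool) (x : ι ⊕ (K ⊕ K) → Bool),
      Sum.elim (x ∘ Sum.inl) (Sum.elim (x ∘ Sum.inr ∘ Sum.inl) a) ∘ varWire = x ∘ varWire := by
    intro a x
    funext i
    rcases i with i | i <;> rfl
  have hV' : ∀ (o : Option (ι ⊕ K)) (x : ι ⊕ (K ⊕ K) → Bool),
      (o.map varWire).elim 0 x = o.elim 0 (x ∘ varWire) := by
    rintro (_ | i) x <;> rfl
  have iO : Injective (fun j => (Sum.inl (out j) : ι ⊕ (K ⊕ K))) := Sum.inl_injective.comp hout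
  set N := hadamardScale ^ Fintype.card K with hN
  refine (Prep.ofReachesPadded (A := K ⊕ K) (Reaches.mono (d := 11)
    (s := Fintype.card K + (Fintype.card K + (Fintype.card K + (Fintype.card K + (Fintype.card K +
      (Fintype.card (K ⊕ K) + (Fintype.card J + (Fintype.card K + (Fintype.card K +
      (Fintype.card K + (Fintype.card L + 0))))))))))) (k := 2)
    ?_ le_rfl (by rw [Fintype.card_sum]; omega) le_rfl)).mono le_rfl le_rfl le_rfl
    (by rw [Fintype.card_sum]; omega)
  -- Hadamard gates put the variable qubits in uniform superposition. The next three CNOT layers add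
  -- the three possible terms of every constraint to its check qubit; `h₁` and `h₂` keep the
  -- controls within a layer distinct.
  refine Reaches.single_of_eq (fun _ x => N * (ind (∀ k, x (Sum.inr (Sum.inr k)) = 0) *
    v (x ∘ Sum.inl))) iP (fun _ _ => hadamard) (fun _ x => ?_) ?_
  · simp only [DynamicCircuit.parOp, embedVec_inl, extend_middle]
    rw [Fintype.sum_eq_single 0]
    · rw [hN]
      congr 1
      · simp [hadamard_apply]
      · congr 2
        simp
    · intro c hc
      rw [ind_false, zero_mul, mul_zero]
      contrapose! hc
      exact funext fun k => hc (Sum.inl k)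
  refine Reaches.cnot_of_eq (fun _ x => N * (ind (∀ k, x (Sum.inr (Sum.inr k)) +
    x (Sum.inr (Sum.inl k)) = 0) * v (x ∘ Sum.inl))) iP iC (by simp) (fun _ x => ?_) ?_
  · simp only [DynamicCircuit.cnotOp, extend_right]
    rfl
  refine Reaches.cnot_option_of_eq (fun _ x => N * (ind (∀ k, x (Sum.inr (Sum.inr k)) +
    (src₁ k).elim 0 (x ∘ varWire) +
    x (Sum.inr (Sum.inl k)) = 0) * v (x ∘ Sum.inl))) (c := fun k => (src₁ k).map varWire)
    ?_ iC ?_ (fun _ x => ?_) ?_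
  · intro a b i ha hb
    rw [Option.map_eq_some_iff] at ha hb
    obtain ⟨a', ha, rfl⟩ := ha
    obtain ⟨b', hb, hab⟩ := hb
    exact h₁ a b _ ha (iV hab ▸ hb)
  · intro a b hab
    rw [Option.map_eq_some_iff] at hab
    obtain ⟨i | i, -, hi⟩ := hab <;> simp [varWire] at hi
  · simp only [extend_right, hV']
    rfl
  refine Reaches.cnot_option_of_eq (fun _ x => N * (ind (∀ k, x (Sum.inr (Sum.inr k)) +
    constraint src₁ src₂ (x ∘ varWire) k = 0) * v (x ∘ Sum.inl)))
    (c := fun k => (src₂ k).map varWire)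
    ?_ iC ?_ (fun _ x => ?_) ?_
  · intro a b i ha hb
    rw [Option.map_eq_some_iff] at ha hb
    obtain ⟨a', ha, rfl⟩ := ha
    obtain ⟨b', hb, hab⟩ := hb
    exact h₂ a b _ ha (iV hab ▸ hb)
  · intro a b hab
    rw [Option.map_eq_some_iff] at hab
    obtain ⟨i | i, -, hi⟩ := hab <;> simp [varWire] at hi
  · simp only [extend_right, hV', hV]
    congr 2
    · congr 1
      refine propext (forall_congr' fun k => ?_)
      simp only [constraint, Sum.elim_inr]
      rw [show ∀ a b c d : Bool, a + b + c + d = a + (d + c + b) by intros; ring]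
      rfl
  refine .measure _ _ _ _ _ _ _ K _ iC le_rfl ?_
  -- The outcome `p.2` is the vector of constraint values. By linearity, adding to the variables the
  -- zero-input solution `b p.2` makes every constraint vanish, and `hM` then forces the variables
  -- to equal `M y`. The same layer resets the check qubits.
  refine Reaches.single_of_eq (T := K ⊕ K) (q := Sum.inr) (fun _ x => N *
    (ind (∀ k, x (Sum.inr (Sum.inr k)) = 0) *
      (ind (∀ k, x (Sum.inr (Sum.inl k)) = linMap M (fun l => x (Sum.inl (inp l))) k) *
      v (x ∘ Sum.inl)))) Sum.inr_injective (fun p => fun i => flip (Sum.elim (b p.2) p.2 i))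
      (fun p x => ?_) ?_
  · simp only [coe_flip, parOp_flip, extend_inr, Sum.elim_inr, bool_add_eq_right]
    rw [mul_left_comm]
    congr 1
    refine ind_mul_congr fun hx => ?_
    congr 2
    refine (forall_congr' fun k => ?_).trans (hM (x ∘ varWire)) |> propext
    rw [show (Sum.elim (x ∘ Sum.inl) fun t => x (Sum.inr t) + Sum.elim (b p.2) p.2 t) ∘ varWire =
      x ∘ varWire + Sum.elim (0 : ι → Bool) (b p.2) from ?_, constraint_add, hb, hx k]
    · rw [show ∀ a c : Bool, 0 + c + (a + c) = a + (c + c) by intros; ring, bool_add_self, add_zero]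
    · funext i
      rcases i with i | i
      · exact (add_zero _).symm
      · rfl
  refine Reaches.cnot_of_eq (T := J) (fun _ x => N *
    (ind (∀ k, x (Sum.inr (Sum.inr k)) = 0) *
      (ind (∀ k, x (Sum.inr (Sum.inl k)) = linMap M (fun l => x (Sum.inl (inp l))) k) *
      w (x ∘ Sum.inl)))) (c := fun j => Sum.inr (Sum.inl (sel j)))
      (fun a b h => hsel (by simpa using h)) iO (by simp) (fun p x => ?_) ?_
  · simp only [DynamicCircuit.cnotOp, extend_inl hout, Sum.elim_inr, Sum.elim_inl, Sum.elim_comp_inl]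
    simp only [comp_apply]
    congr 2
    have hl : ∀ (a : J → Bool) l, extend out a (x ∘ Sum.inl) (inp l) = x (Sum.inl (inp l)) := by
      intro a l
      rw [extend_apply']
      · rfl
      · rintro ⟨j, hj⟩
        exact hio l j hj.symm
    simp only [hl]
    refine ind_mul_congr fun hx => ?_
    rw [hw]
    simp only [hx, comp_apply]
  -- The variables now hold definite values for each `y`, so a Hadamard layer makes every outcome of
  -- their measurement equally likely and leaves only a sign.
  refine Reaches.single_of_eq (fun _ x => N * N * (ind (∀ k, x (Sum.inr (Sum.inr k)) = 0) *
    ((∏ k, sgn (x (Sum.inr (Sum.inl k)) * linMap M (fun l => x (Sum.inl (inp l))) k)) *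
      w (x ∘ Sum.inl)))) iP (fun _ _ => hadamard) (fun _ x => ?_) ?_
  · simp only [DynamicCircuit.parOp, extend_middle, Sum.elim_inr, Sum.elim_inl, comp_apply]
    rw [Fintype.sum_eq_single (linMap M (fun l => x (Sum.inl (inp l))))]
    · rw [ind_true (fun _ => rfl)]
      simp only [hadamard_apply, Finset.prod_mul_distrib, Finset.prod_const, Finset.card_univ,
        Sum.elim_comp_inl, ← hN]
      ring
    · intro c hc
      rw [ind_false (p := ∀ k, c k = _)]
      · ring
      · contrapose! hc
        exact funext hc
  refine .measure _ _ _ _ _ _ _ K _ iP le_rfl ?_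
  refine Reaches.single_of_eq (fun p x => N * N * ((∏ k, sgn (p.2 k * linMap M (fun l =>
    x (Sum.inl (inp l))) k)) * embedVec Sum.inl w x)) iP (fun p k => flip (p.2 k))
      (fun p x => ?_) ?_
  · simp only [coe_flip, parOp_flip, extend_middle, Sum.elim_inr, Sum.elim_inl, bool_add_eq_right,
      embedVec_inl, comp_apply, Sum.elim_comp_inl, Sum.forall, ind_and]
    trans ind (∀ k, x (Sum.inr (Sum.inl k)) = 0) * (N * N *
      (ind (∀ k, x (Sum.inr (Sum.inr k)) = 0) *
      ((∏ k, sgn ((x (Sum.inr (Sum.inl k)) + p.2 k) * linMap M (fun l => x (Sum.inl (inp l))) k)) *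
      w (x ∘ Sum.inl))))
    · rfl
    trans ind (∀ k, x (Sum.inr (Sum.inl k)) = 0) * (N * N *
      (ind (∀ k, x (Sum.inr (Sum.inr k)) = 0) *
      ((∏ k, sgn (p.2 k * linMap M (fun l => x (Sum.inl (inp l))) k)) *
      w (x ∘ Sum.inl))))
    · refine ind_mul_congr fun hx => ?_
      simp only [hx, zero_add]
    · ring
  -- The sign left by the outcome `p.2` has exponent `p.2 · M y`, a linear form in the inputs, so it
  -- factors into one `Z` power per input wire.
  refine Reaches.single_of_eq (T := L) (q := fun l => Sum.inl (inp l))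
    (fun p x => N * N * embedVec Sum.inl w x) (Sum.inl_injective.comp hinp)
    (fun p l => signFlip (∑ k, p.2 k * M k l)) (fun p x => ?_) ?_
  · simp only [coe_signFlip, parOp_diagonal]
    rw [mul_left_comm, ← mul_assoc (∏ l, _)]
    conv_rhs => rw [← one_mul (embedVec _ _ _)]
    congr 2
    rw [← sgn_sum, ← sgn_sum, ← sgn_add]
    simp only [linMap, Finset.mul_sum, Finset.sum_mul]
    rw [Finset.sum_comm, show ∀ a c : Bool, a = c → (sgn (a + c) : ℂ) = 1 from ?_]
    · exact Finset.sum_congr rfl fun _ _ => Finset.sum_congr rfl fun _ _ => by ring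
    · rintro a _ rfl
      rw [bool_add_self, sgn_zero]
  exact .done _ _ _ _ _ _ fun p => ⟨N * N, rfl⟩

end Linear

/-! ### Copies and partial sums as sparse constraints -/

section Chain

/-- The value preceding `c j`, where `a` precedes the first value. -/
def prevValue {n : ℕ} (a : Bool) (c : Fin n → Bool) (j : Fin n) : Bool :=
  if h : j.val = 0 then a else c ⟨j.val - 1, by omega⟩

theorem sum_lt_succ {n : ℕ} (m : Fin n → Bool) (j : Fin n) :
    ∑ i : Fin n, (if i.val < j.val + 1 then m i else 0) =
      (∑ i : Fin n, if i.val < j.val then m i else 0) + m j := by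
  have : m j = ∑ i : Fin n, if i = j then m i else 0 := by simp
  rw [this, ← Finset.sum_add_distrib]
  refine Finset.sum_congr rfl fun i _ => ?_
  rcases lt_trichotomy i j with h | h | h
  · have h' : i.val < j.val := h
    simp [h', h.ne, Nat.lt_succ_of_lt h']
  · subst h; simp
  · have h' : j.val < i.val := h
    simp [h.ne', show ¬ i.val < j.val by omega, show ¬ i.val < j.val + 1 by omega]

/-- Each equation fixes a value from its predecessor, so the chain telescopes into prefix sums. With
`m = 0` it copies `a`; with summands as `m` it accumulates a parity. -/
theorem chain_iff {n : ℕ} (a : Bool) (c m : Fin n → Bool) :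
    (∀ j, c j + prevValue a c j = m j) ↔
      ∀ j, c j = a + ∑ i : Fin n, if i.val < j.val + 1 then m i else 0 := by
  have key : ∀ x y z : Bool, x + y = z ↔ x = y + z := by
    intro x y z
    constructor
    · rintro rfl
      rw [add_left_comm, bool_add_self, add_zero]
    · rintro rfl
      rw [add_right_comm, bool_add_self, zero_add]
  constructor
  · intro h j
    obtain ⟨j, hj⟩ := j
    induction j with
    | zero =>
      have := h ⟨0, hj⟩
      rw [key] at this
      rw [this, sum_lt_succ]
      simp [prevValue]
    | succ j ih =>
      have := h ⟨j + 1, hj⟩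
      rw [key] at this
      rw [this, sum_lt_succ, ← add_assoc, ← ih (by omega)]
      simp [prevValue]
  · intro h j
    rw [key, h j, sum_lt_succ, ← add_assoc]
    congr 1
    unfold prevValue
    split_ifs with h0
    · simp [h0]
    · rw [h]
      simp only [show j.val - 1 + 1 = j.val by omega]

end Chain

section Grid

variable {ι G : Type} {r s : ℕ}

/-- The variables of the linear system that computes `s` parities of `r` bits, for every `g : G`:
copies of the bits and partial sums of the parities. -/
abbrev GridVar (G : Type) (r s : ℕ) : Type := (G × Fin r × Fin s) ⊕ (G × Fin r × Fin s)

/-- The first further variable of a constraint: the previous copy or partial sum. -/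
def gridSource₁ (inp : G × Fin r → ι) : GridVar G r s → Option (ι ⊕ GridVar G r s)
  | .inl (g, i, j) => if h : j.val = 0 then some (Sum.inl (inp (g, i)))
      else some (Sum.inr (Sum.inl (g, i, ⟨j.val - 1, by omega⟩)))
  | .inr (g, i, j) => if h : i.val = 0 then none
      else some (Sum.inr (Sum.inr (g, ⟨i.val - 1, by omega⟩, j)))

/-- The second further variable of a constraint: the copy added to a partial sum. -/
def gridSource₂ (A : G → Fin s → Fin r → Bool) : GridVar G r s → Option (ι ⊕ GridVar G r s)
  | .inl _ => none
  | .inr (g, i, j) => if A g j i then some (Sum.inr (Sum.inl (g, i, j))) else none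

theorem constraint_inl (inp : G × Fin r → ι) (A : G → Fin s → Fin r → Bool)
    (z : ι ⊕ GridVar G r s → Bool) (g : G) (i : Fin r) (j : Fin s) :
    constraint (gridSource₁ inp) (gridSource₂ A) z (Sum.inl (g, i, j)) =
      z (Sum.inr (Sum.inl (g, i, j))) +
        prevValue (z (Sum.inl (inp (g, i)))) (fun j => z (Sum.inr (Sum.inl (g, i, j)))) j := by
  unfold constraint prevValue gridSource₁ gridSource₂
  by_cases h : j.val = 0 <;> simp [h]

theorem constraint_inr (inp : G × Fin r → ι) (A : G → Fin s → Fin r → Bool)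
    (z : ι ⊕ GridVar G r s → Bool) (g : G) (i : Fin r) (j : Fin s) :
    constraint (gridSource₁ inp) (gridSource₂ A) z (Sum.inr (g, i, j)) =
      z (Sum.inr (Sum.inr (g, i, j))) +
        prevValue 0 (fun i => z (Sum.inr (Sum.inr (g, i, j)))) i +
        A g j i * z (Sum.inr (Sum.inl (g, i, j))) := by
  unfold constraint prevValue gridSource₁ gridSource₂
  have h1 : ∀ b : Bool, true * b = b := Bool.true_and
  have h2 : ∀ b : Bool, false * b = 0 := Bool.false_and
  by_cases h : i.val = 0 <;> by_cases hA : A g j i = true <;> simp [h, hA, h1, h2]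

/-- An input feeds only its first copy, a copy only the next copy, and a partial sum only the next
partial sum. As a second source, a copy feeds only its own partial sum; one copy per output is made
precisely for this. -/
theorem gridSource₁_injective {inp : G × Fin r → ι} (hinp : Injective inp) :
    ∀ (a b : GridVar G r s) (w : ι ⊕ GridVar G r s),
      gridSource₁ inp a = some w → gridSource₁ inp b = some w → a = b := by
  rintro (⟨g, i, j⟩ | ⟨g, i, j⟩) (⟨g', i', j'⟩ | ⟨g', i', j'⟩) w ha hb <;>
    simp only [gridSource₁] at ha hb <;> split_ifs at ha hb <;>
    rw [← hb] at ha <;>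
    simp only [Option.some.injEq, reduceCtorEq, Sum.inr.injEq, Sum.inl.injEq, Prod.mk.injEq,
      Fin.mk.injEq] at ha ⊢
  · have := hinp ha
    simp only [Prod.mk.injEq] at this
    exact ⟨this.1, this.2, Fin.ext (by omega)⟩
  · exact ⟨ha.1, ha.2.1, Fin.ext (by omega)⟩
  · exact ⟨ha.1, Fin.ext (by omega), ha.2.2⟩

theorem gridSource₂_injective (A : G → Fin s → Fin r → Bool) :
    ∀ (a b : GridVar G r s) (w : ι ⊕ GridVar G r s),
      gridSource₂ A a = some w → gridSource₂ A b = some w → a = b := by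
  rintro (a | ⟨g, i, j⟩) (b | ⟨g', i', j'⟩) w ha hb
  · exact absurd ha (by simp [gridSource₂])
  · exact absurd ha (by simp [gridSource₂])
  · exact absurd hb (by simp [gridSource₂])
  · simp only [gridSource₂] at ha hb
    split_ifs at ha hb
    rw [← hb] at ha
    simpa using ha

/-- The system is triangular: prefix sums solve for the copies, and then, with the copies known, for
the partial sums. -/
theorem grid_surjective (inp : G × Fin r → ι) (A : G → Fin s → Fin r → Bool)
    (m : GridVar G r s → Bool) :
    ∃ b : GridVar G r s → Bool,
      ∀ k, constraint (gridSource₁ inp) (gridSource₂ A) (Sum.elim 0 b) k = m k := by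
  let c : G × Fin r × Fin s → Bool := fun p =>
    0 + ∑ j' : Fin s, if j'.val < p.2.2.val + 1 then m (Sum.inl (p.1, p.2.1, j')) else 0
  let d : G × Fin r × Fin s → Bool := fun p =>
    0 + ∑ i' : Fin r, if i'.val < p.2.1.val + 1 then
      m (Sum.inr (p.1, i', p.2.2)) + A p.1 p.2.2 i' * c (p.1, i', p.2.2) else 0
  refine ⟨Sum.elim c d, ?_⟩
  rintro (⟨g, i, j⟩ | ⟨g, i, j⟩)
  · rw [constraint_inl]
    exact (chain_iff 0 (fun j => c (g, i, j)) (fun j => m (Sum.inl (g, i, j)))).2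
      (fun j => rfl) j
  · rw [constraint_inr]
    have := (chain_iff 0 (fun i => d (g, i, j))
      (fun i => m (Sum.inr (g, i, j)) + A g j i * c (g, i, j))).2 (fun i => rfl) i
    simp only [Sum.elim_inr, Sum.elim_inl]
    rw [this, add_assoc, bool_add_self, add_zero]

variable [Fintype G] [DecidableEq G]

/-- The solution of the linear system. -/
def gridMatrix (A : G → Fin s → Fin r → Bool) : GridVar G r s → G × Fin r → Bool
  | .inl (g, i, _), p => decide (p = (g, i))
  | .inr (g, i, j), p => decide (p.1 = g) * (decide (p.2.val < i.val + 1) * A g j p.2)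

theorem linMap_gridMatrix_inl (A : G → Fin s → Fin r → Bool) (y : G × Fin r → Bool)
    (g : G) (i : Fin r) (j : Fin s) :
    linMap (gridMatrix A) y (Sum.inl (g, i, j)) = y (g, i) := by
  rw [linMap, Fintype.sum_eq_single (g, i)]
  · simp only [gridMatrix, decide_true]
    exact one_mul _
  · intro p hp
    simp only [gridMatrix, hp, decide_false]
    exact zero_mul _

theorem linMap_gridMatrix_inr (A : G → Fin s → Fin r → Bool) (y : G × Fin r → Bool)
    (g : G) (i : Fin r) (j : Fin s) :
    linMap (gridMatrix A) y (Sum.inr (g, i, j)) =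
      ∑ i' : Fin r, if i'.val < i.val + 1 then A g j i' * y (g, i') else 0 := by
  rw [linMap, Fintype.sum_prod_type, Fintype.sum_eq_single g]
  · refine Finset.sum_congr rfl fun i' _ => ?_
    simp only [gridMatrix, decide_true]
    split_ifs with h
    · rw [decide_eq_true h]
      exact congrArg (· * y (g, i')) ((one_mul _).trans (one_mul _))
    · rw [decide_eq_false h]
      rw [show (false : Bool) = 0 from rfl, zero_mul, mul_zero, zero_mul]
  · intro g' hg
    refine Finset.sum_eq_zero fun i' _ => ?_
    simp only [gridMatrix, hg, decide_false]
    rw [show (false : Bool) = 0 from rfl, zero_mul, zero_mul]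

theorem grid_solution (inp : G × Fin r → ι) (A : G → Fin s → Fin r → Bool)
    (z : ι ⊕ GridVar G r s → Bool) :
    (∀ k, constraint (gridSource₁ inp) (gridSource₂ A) z k = 0) ↔
      ∀ k, z (Sum.inr k) = linMap (gridMatrix A) (fun l => z (Sum.inl (inp l))) k := by
  have hc : (∀ g i j, constraint (gridSource₁ inp) (gridSource₂ A) z (Sum.inl (g, i, j)) = 0) ↔
      ∀ g i j, z (Sum.inr (Sum.inl (g, i, j))) = z (Sum.inl (inp (g, i))) := by
    refine forall_congr' fun g => forall_congr' fun i => ?_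
    simp only [constraint_inl]
    refine (chain_iff _ (fun j => z (Sum.inr (Sum.inl (g, i, j)))) (fun _ => 0)).trans ?_
    simp
  have hd : ∀ g j, (∀ i, constraint (gridSource₁ inp) (gridSource₂ A) z (Sum.inr (g, i, j)) = 0) ↔
      ∀ i, z (Sum.inr (Sum.inr (g, i, j))) = ∑ i' : Fin r,
        if i'.val < i.val + 1 then A g j i' * z (Sum.inr (Sum.inl (g, i', j))) else 0 := by
    intro g j
    simp only [constraint_inr, bool_add_eq_zero]
    refine (chain_iff 0 (fun i => z (Sum.inr (Sum.inr (g, i, j)))) _).trans ?_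
    simp
  simp only [Sum.forall, Prod.forall, linMap_gridMatrix_inl, linMap_gridMatrix_inr]
  rw [hc]
  refine and_congr_right fun h => ?_
  refine forall_congr' fun g => ?_
  rw [forall_comm, forall_comm (α := Fin r)]
  refine forall_congr' fun j => ?_
  rw [hd]
  simp only [h]

/-- The output parity is the last partial sum; having `r + 1` inputs guarantees that there is one.
-/
theorem Prep.linear_fin (v : QV ι) (inp : G × Fin (r + 1) → ι) (out : G × Fin s → ι)
    (hinp : Injective inp) (hout : Injective out) (hio : ∀ l j, inp l ≠ out j)
    (A : G → Fin s → Fin (r + 1) → Bool) :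
    Prep v (fun y => v (extend out
        (fun p => y (out p) + ∑ i, A p.1 p.2 i * y (inp (p.1, i))) y))
      11 (10 * Fintype.card (GridVar G (r + 1) s) + Fintype.card (G × Fin s) +
        Fintype.card (G × Fin (r + 1))) 2 (2 * Fintype.card (GridVar G (r + 1) s)) := by
  have h := Prep.linear_of_constraints v inp out
    (fun p => (Sum.inr (p.1, Fin.last r, p.2) : GridVar G (r + 1) s)) hinp hout
    (fun p q h => by
      simp only [Sum.inr.injEq, Prod.mk.injEq, true_and] at h
      exact Prod.ext h.1 h.2) hio
    (gridMatrix A) (gridSource₁ inp) (gridSource₂ A) ?_ ?_ (grid_surjective inp A)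
    (grid_solution inp A)
  · simp only [linMap_gridMatrix_inr] at h
    convert h using 7 with y p
    rw [if_pos]
    exact Fin.is_lt _
  · exact gridSource₁_injective hinp
  · exact gridSource₂_injective A

theorem Prep.linear {I J : Type} [Fintype I] [Fintype J] [Nonempty I] (v : QV ι)
    (inp : G × I → ι) (out : G × J → ι)
    (hinp : Injective inp) (hout : Injective out) (hio : ∀ l j, inp l ≠ out j)
    (A : G → J → I → Bool) :
    Prep v (fun y => v (extend out
        (fun p => y (out p) + ∑ i, A p.1 p.2 i * y (inp (p.1, i))) y))
      11 (22 * (Fintype.card G * (Fintype.card I * (Fintype.card J + 1)))) 2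
        (22 * (Fintype.card G * (Fintype.card I * (Fintype.card J + 1)))) := by
  obtain ⟨r, hr⟩ : ∃ r, Fintype.card I = r + 1 :=
    ⟨Fintype.card I - 1, by have := Fintype.card_pos (α := I); omega⟩
  let eI : Fin (r + 1) ≃ I := (finCongr hr.symm).trans (Fintype.equivFin I).symm
  let eJ : Fin (Fintype.card J) ≃ J := (Fintype.equivFin J).symm
  have h := Prep.linear_fin v (fun p => inp (p.1, eI p.2)) (fun p => out (p.1, eJ p.2))
    (fun p q h => by simpa [Prod.ext_iff] using hinp h)
    (fun p q h => by simpa [Prod.ext_iff] using hout h) (fun _ _ => hio _ _)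
    (fun g j i => A g (eJ j) (eI i))
  have hw : (fun y => v (extend (fun p : G × Fin (Fintype.card J) => out (p.1, eJ p.2))
        (fun p => y (out (p.1, eJ p.2)) +
          ∑ i, A p.1 (eJ p.2) (eI i) * y (inp (p.1, eI i))) y)) =
      (fun y => v (extend out
        (fun p => y (out p) + ∑ i, A p.1 p.2 i * y (inp (p.1, i))) y)) := by
    funext y
    congr 1
    funext w
    by_cases hw : ∃ p, out p = w
    · obtain ⟨⟨g, j⟩, rfl⟩ := hw
      obtain ⟨j, rfl⟩ := eJ.surjective j
      rw [hout.extend_apply]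
      refine (Injective.extend_apply (f := fun p : G × Fin (Fintype.card J) => out (p.1, eJ p.2))
        (fun p q h => by simpa [Prod.ext_iff] using hout h) _ _ (g, j)).trans ?_
      congr 1
      exact Equiv.sum_comp eI (fun i => A g (eJ j) i * y (inp (g, i)))
    · rw [extend_apply' _ _ _ hw, extend_apply']
      rintro ⟨p, hp⟩
      exact hw ⟨_, hp⟩
  rw [hw] at h
  refine h.mono le_rfl ?_ le_rfl ?_ <;>
    simp only [GridVar, Fintype.card_sum, Fintype.card_prod, Fintype.card_fin, hr] <;> nlinarith
      [Nat.zero_le (Fintype.card G * (r * Fintype.card J)), Nat.zero_le (Fintype.card G * r),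
      Nat.zero_le (Fintype.card G * Fintype.card J), Nat.zero_le (Fintype.card G)]

theorem Prep.linear_single {I J : Type} [Fintype I] [Fintype J] [Nonempty I] (v : QV ι)
    (inp : I → ι) (out : J → ι) (hinp : Injective inp) (hout : Injective out)
    (hio : ∀ i j, inp i ≠ out j) (A : J → I → Bool) :
    Prep v (fun y => v (extend out (fun j => y (out j) + ∑ i, A j i * y (inp i)) y))
      11 (22 * (Fintype.card I * (Fintype.card J + 1))) 2
        (22 * (Fintype.card I * (Fintype.card J + 1))) := by
  have h := Prep.linear (G := Unit) v (fun p => inp p.2) (fun p => out p.2)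
    (fun p q h => Prod.ext rfl (hinp h)) (fun p q h => Prod.ext rfl (hout h)) (fun _ _ => hio _ _)
    (fun _ => A)
  rw [Fintype.card_unit, one_mul] at h
  convert h using 3 with y
  funext w
  by_cases hw : ∃ j, out j = w
  · obtain ⟨j, rfl⟩ := hw
    rw [hout.extend_apply]
    exact (Injective.extend_apply (f := fun p : Unit × J => out p.2)
      (fun p q h => Prod.ext rfl (hout h))
      (fun p => y (out p.2) + ∑ i, A p.2 i * y (inp i)) y ((), j)).symm
  · rw [extend_apply' _ _ _ hw, extend_apply']
    rintro ⟨p, hp⟩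
    exact hw ⟨_, hp⟩

end Grid

/-! ### Walsh expansion in parities -/

section Walsh

variable {I : Type} [Fintype I] [DecidableEq I]

/-- Orthogonality of characters: the sum over `S` factors over the coordinates, and a coordinate
where `x` and `y` differ contributes `1 - 1`. -/
theorem sum_sgn_mul_sgn (x y : I → Bool) :
    ∑ S : I → Bool, (sgn (∑ i, S i * x i) * sgn (∑ i, S i * y i) : ℝ) =
      if x = y then 2 ^ Fintype.card I else 0 := by
  have h : ∀ S : I → Bool, (sgn (∑ i, S i * x i) * sgn (∑ i, S i * y i) : ℝ) =
      ∏ i, sgn (S i * (x i + y i)) := by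
    intro S
    simp only [mul_add, sgn_add, sgn_sum, Finset.prod_mul_distrib]
  simp only [h]
  rw [← Fintype.prod_sum (fun i b => (sgn (b * (x i + y i)) : ℝ))]
  have h₁ : ∀ a : Bool, true * a = a := one_mul
  have h₂ : ∀ a : Bool, false * a = 0 := zero_mul
  split_ifs with hxy
  · subst hxy
    simp only [bool_add_self, mul_zero, sgn_zero]
    norm_num
  · obtain ⟨i, hi⟩ : ∃ i, x i ≠ y i := by
      by_contra! h; exact hxy (funext h)
    refine Finset.prod_eq_zero (Finset.mem_univ i) ?_
    have hi' : x i + y i = true := by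
      rw [← Bool.not_eq_false]
      exact fun h => hi (bool_add_eq_zero.1 h)
    rw [hi', Fintype.sum_bool, h₁, h₂]
    simp

/-- Every real function of finitely many bits is, up to a constant, a combination of parities. -/
theorem exists_parity_expansion (φ : (I → Bool) → ℝ) :
    ∃ (γ : (I → Bool) → ℝ) (c : ℝ), ∀ x,
      ∑ S : I → Bool, (if ∑ i, S i * x i then γ S else 0) = φ x + c := by
  set N : ℝ := 2 ^ Fintype.card I with hN
  have hN0 : N ≠ 0 := by positivity
  -- A parity bit is `(1 - sgn)/2`, so these are the Walsh coefficients times `-2`; the halves that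
  -- carry no sign add up to the constant.
  let γ : (I → Bool) → ℝ := fun S => -2 / N * ∑ y, φ y * sgn (∑ i, S i * y i)
  refine ⟨γ, ∑ S, γ S / 2, fun x => ?_⟩
  have h : ∀ S, (if ∑ i, S i * x i then γ S else 0) =
      γ S / 2 - γ S / 2 * sgn (∑ i, S i * x i) := by
    intro S
    rcases ∑ i, S i * x i <;> simp
  simp only [h, Finset.sum_sub_distrib]
  have h' : ∑ S, γ S / 2 * sgn (∑ i, S i * x i) = - φ x := by
    trans ∑ S : I → Bool, ∑ y, -(φ y / N) * (sgn (∑ i, S i * y i) * sgn (∑ i, S i * x i))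
    · refine Finset.sum_congr rfl fun S _ => ?_
      simp only [γ, Finset.mul_sum, Finset.sum_mul, Finset.sum_div]
      refine Finset.sum_congr rfl fun y _ => ?_
      field_simp
    · rw [Finset.sum_comm]
      simp only [← Finset.mul_sum, sum_sgn_mul_sgn]
      simp only [mul_ite, mul_zero, Finset.sum_ite_eq', Finset.mem_univ, if_true]
      rw [← hN]
      field_simp
  rw [h']
  ring

end Walsh

theorem Prep.of_smul {ι : Type} {v w u : QV ι} {d s k a : ℕ} (h : Prep v w d s k a) (c : ℂ)
    (hw : w = c • u) : Prep v u d s k a :=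
  h.trans (Prep.ofReaches (d := 0) (s := 0) (k := 0) (.done _ _ _ _ _ _ fun _ => ⟨c, hw⟩))

/-! ### Diagonal operators and conjunctions -/

section Diagonal

variable {ι G I : Type} [Fintype G] [DecidableEq G] [Fintype I] [DecidableEq I]

/-- All `2 ^ |I|` parities of each block are written to fresh qubits, each qubit receives its own
phase, and adding the parities again clears them. The constants of the Walsh expansions amount to a
global phase. -/
theorem Prep.diagonal [Nonempty I] (v : QV ι) (inp : G × I → ι) (hinp : Injective inp)
    (φ : G → (I → Bool) → ℝ) :
    Prep v (fun y => (∏ g, Complex.exp (φ g (fun i => y (inp (g, i))) * Complex.I)) * v y) 23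
      (45 * (Fintype.card G * (Fintype.card I * (2 ^ Fintype.card I + 1)))) 4
      (45 * (Fintype.card G * (Fintype.card I * (2 ^ Fintype.card I + 1)))) := by
  choose γ c hγ using fun g => exists_parity_expansion (φ g)
  set V₀ : QV (ι ⊕ (G × (I → Bool))) := embedVec Sum.inl v with hV₀
  let par : (ι ⊕ (G × (I → Bool)) → Bool) → G × (I → Bool) → Bool := fun y p =>
    ∑ i, p.2 i * y (Sum.inl (inp (p.1, i)))
  have hinp' : Injective fun p => (Sum.inl (inp p) : ι ⊕ (G × (I → Bool))) :=
    Sum.inl_injective.comp hinp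
  have l₁ := Prep.linear V₀ _ (Sum.inr : G × (I → Bool) → _) hinp' Sum.inr_injective (by simp)
    (fun _ S i => S i)
  set V₁ : QV (ι ⊕ (G × (I → Bool))) :=
    fun y => V₀ (extend Sum.inr (fun p => y (Sum.inr p) + par y p) y) with hV₁
  have l₂ := Prep.parOp (Sum.inr_injective : Injective (Sum.inr : G × (I → Bool) → ι ⊕ _))
    (fun p => phase fun b => if b then γ p.1 p.2 else 0) V₁
  set V₂ := DynamicCircuit.parOp (Sum.inr : G × (I → Bool) → ι ⊕ _) (fun p =>
    (phase fun b => if b then γ p.1 p.2 else 0 : Matrix Bool Bool ℂ)) V₁ with hV₂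
  have l₃ := Prep.linear V₂ _ (Sum.inr : G × (I → Bool) → _) hinp' Sum.inr_injective (by simp)
    (fun _ S i => S i)
  have l := ((l₁.trans l₂).trans l₃).of_smul (u := embedVec Sum.inl (fun y =>
    (∏ g, Complex.exp (φ g (fun i => y (inp (g, i))) * Complex.I)) * v y))
    (∏ g, Complex.exp (c g * Complex.I)) (funext fun y => ?_)
  · refine l.alloc.mono (by norm_num) ?_ (by norm_num) ?_ <;>
      simp only [Fintype.card_prod, Fintype.card_fun, Fintype.card_bool] <;>
      nlinarith [Nat.mul_le_mul_left (Fintype.card G)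
        (Nat.le_mul_of_pos_left (2 ^ Fintype.card I + 1) (Fintype.card_pos (α := I)))]
  · have hpar : ∀ (a : G × (I → Bool) → Bool), par (extend Sum.inr a y) = par y := by
      intro a
      simp only [par, extend_inr, Sum.elim_inl, comp_apply]
    simp only [Pi.smul_apply, smul_eq_mul]
    change V₂ (extend Sum.inr (fun p => y (Sum.inr p) + par y p) y) = _
    rw [hV₂]
    simp only [coe_phase, parOp_diagonal]
    rw [hV₁]
    simp only [hpar, Sum.inr_injective.extend_apply, extend_extend Sum.inr_injective, add_assoc,
      bool_add_self, add_zero, extend_self]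
    rw [hV₀, embedVec_inl, embedVec_inl, mul_left_comm, mul_left_comm (∏ g, _)]
    refine ind_mul_congr fun hy => ?_
    rw [← mul_assoc]
    congr 1
    rw [← Finset.prod_mul_distrib, Fintype.prod_prod_type]
    refine Finset.prod_congr rfl fun g _ => ?_
    rw [← Complex.exp_add, ← Complex.exp_sum, ← add_mul, ← Complex.ofReal_add,
      ← Finset.sum_mul, ← Complex.ofReal_sum]
    simp only [hy, zero_add]
    congr 3
    exact (hγ g fun i => y (Sum.inl (inp (g, i)))).trans (add_comm _ _)

theorem hadamard_sgn_hadamard (f : Bool) :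
    (hadamard : Matrix Bool Bool ℂ) * (Matrix.diagonal fun i => sgn (i * f)) *
      (hadamard : Matrix Bool Bool ℂ) =
      flipMatrix f := by
  have h := hadamardScale_sq
  have h₁ : ∀ a : Bool, true * a = a := one_mul
  have h₂ : ∀ a : Bool, false * a = false := zero_mul
  have h₃ : ∀ a b : Bool, a + b = xor a b := fun _ _ => rfl
  ext i j
  rw [Matrix.mul_apply, Fintype.sum_bool]
  simp only [Matrix.mul_diagonal, hadamard_apply, flipMatrix, h₃]
  cases i <;> cases j <;> cases f <;> simp [h₁, h₂] <;> linear_combination 2 * h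

/-- Since `H Z^f H = X^f`, a diagonal sign between Hadamard layers adds `f` to the targets. By `hf`
the value `f` does not read the targets, so it is constant along the sums. -/
theorem parOp_hadamard_sgn {T : Type} [Fintype T] [DecidableEq T] {w : T → ι} (hw : Injective w)
    (f : (ι → Bool) → T → Bool) (hf : ∀ b x, f (extend w b x) = f x) (v : QV ι) :
    parOp w (fun _ => (hadamard : Matrix Bool Bool ℂ)) (fun y => (∏ t, sgn (y (w t) * f y t)) *
      parOp w (fun _ => (hadamard : Matrix Bool Bool ℂ)) v y) =
      fun x => v (extend w (fun t => x (w t) + f x t) x) := by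
  funext x
  rw [← parOp_flip w (f x) v x]
  simp only [← hadamard_sgn_hadamard]
  rw [← parOp_parOp hw, ← parOp_parOp hw]
  refine Finset.sum_congr rfl fun b _ => ?_
  rw [parOp_diagonal]
  simp only [hf]

/-- The bit that records whether two bit strings are equal. -/
def eqBit {N : Type} [Fintype N] (a b : N → Bool) : Bool := decide (∀ k, a k = b k)

/-- The sign `(-1)^(target · eqBit)` is diagonal on `|N| + 1` qubits. Many patterns `g` may read the
same source, so each gets private copies of its bits first; these make the diagonal blocks disjoint
and are erased at the end. -/
theorem Prep.conjunction {N : Type} [Fintype N] [DecidableEq N] [Nonempty I] (v : QV ι)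
    (src : I → ι) (t : G → ι) (hsrc : Injective src) (ht : Injective t)
    (hst : ∀ i g, src i ≠ t g) (sel : G → N → I) (pat : G → N → Bool) :
    Prep v (fun y => v (extend t
        (fun g => y (t g) + eqBit (fun k => y (src (sel g k))) (pat g)) y)) 47
      (44 * (Fintype.card I * (Fintype.card G * Fintype.card N + 1)) +
        47 * (Fintype.card G * ((Fintype.card N + 1) * (2 ^ (Fintype.card N + 1) + 1)))) 8
      (44 * (Fintype.card I * (Fintype.card G * Fintype.card N + 1)) +
        46 * (Fintype.card G * ((Fintype.card N + 1) * (2 ^ (Fintype.card N + 1) + 1)))) := by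
  set V₀ : QV (ι ⊕ (G × N)) := embedVec Sum.inl v with hV₀
  have hsrc' : Injective fun i => (Sum.inl (src i) : ι ⊕ (G × N)) := Sum.inl_injective.comp hsrc
  have ht' : Injective fun g => (Sum.inl (t g) : ι ⊕ (G × N)) := Sum.inl_injective.comp ht
  have hsum : ∀ (y : ι ⊕ (G × N) → Bool) (p : G × N),
      ∑ i, decide (i = sel p.1 p.2) * y (Sum.inl (src i)) =
        y (Sum.inl (src (sel p.1 p.2))) := by
    intro y p
    rw [Fintype.sum_eq_single (sel p.1 p.2)]
    · rw [decide_eq_true rfl]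
      exact one_mul _
    · intro i hi
      rw [decide_eq_false hi]
      exact zero_mul _
  have l₁ := Prep.linear_single V₀ _ (Sum.inr : G × N → _) hsrc' Sum.inr_injective (by simp)
    (fun p i => decide (i = sel p.1 p.2))
  simp only [hsum] at l₁
  set V₁ : QV (ι ⊕ (G × N)) := fun y =>
    V₀ (extend Sum.inr (fun p => y (Sum.inr p) + y (Sum.inl (src (sel p.1 p.2)))) y) with hV₁
  have l₂ := Prep.parOp ht' (fun _ => hadamard) V₁
  have hinp : Injective fun p : G × Option N =>
      p.2.elim (Sum.inl (t p.1) : ι ⊕ (G × N)) fun k => Sum.inr (p.1, k) := by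
    rintro ⟨g, _ | k⟩ ⟨g', _ | k'⟩ h
    · simpa using ht (Sum.inl_injective h)
    · simp at h
    · simp at h
    · simpa using h
  have l₃ := Prep.diagonal (DynamicCircuit.parOp (fun g => (Sum.inl (t g) : ι ⊕ (G × N)))
    (fun _ => (hadamard : Matrix Bool Bool ℂ)) V₁) _ hinp
    (fun g z => signPhase (z none * eqBit (fun k => z (some k)) (pat g)))
  simp only [Option.elim] at l₃
  simp only [exp_signPhase] at l₃
  have l₄ := (l₂.trans l₃).trans (Prep.parOp ht' (fun _ => hadamard) _)
  rw [parOp_hadamard_sgn ht' (fun y g => eqBit (fun k => y (Sum.inr (g, k))) (pat g))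
    (fun b x => by simp only [extend_inl ht, Sum.elim_inr, comp_apply])] at l₄
  set V₄ : QV (ι ⊕ (G × N)) := fun y => V₁ (extend (fun g => Sum.inl (t g)) (fun g =>
    y (Sum.inl (t g)) + eqBit (fun k => y (Sum.inr (g, k))) (pat g)) y) with hV₄
  have l₅ := Prep.linear_single V₄ _ (Sum.inr : G × N → _) hsrc' Sum.inr_injective (by simp)
    (fun p i => decide (i = sel p.1 p.2))
  simp only [hsum] at l₅
  have l := (l₁.trans l₄).trans l₅
  have hfinal : (fun y => V₄ (extend Sum.inr
      (fun p => y (Sum.inr p) + y (Sum.inl (src (sel p.1 p.2)))) y)) =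
      embedVec Sum.inl (fun y => v (extend t
        (fun g => y (t g) + eqBit (fun k => y (src (sel g k))) (pat g)) y)) := by
    funext y
    have hl : ∀ (a : G → Bool) i, extend t a (y ∘ Sum.inl) (src i) = y (Sum.inl (src i)) := by
      intro a i
      rw [extend_apply']
      · rfl
      · rintro ⟨g, hg⟩
        exact hst i g hg.symm
    simp only [hV₄, hV₁, hV₀, embedVec_inl, extend_inr, extend_inl ht, Sum.elim_inr, Sum.elim_inl,
      comp_apply, Sum.elim_comp_inl, hl]
    simp only [add_assoc, bool_add_self, add_zero]
    refine ind_mul_congr fun hy => ?_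
    simp only [hy, zero_add]
  rw [hfinal] at l
  have hc : Fintype.card G ≤
      Fintype.card G * ((Fintype.card N + 1) * (2 ^ (Fintype.card N + 1) + 1)) :=
    Nat.le_mul_of_pos_right _ (by positivity)
  have hc' : Fintype.card G * Fintype.card N ≤
      Fintype.card G * ((Fintype.card N + 1) * (2 ^ (Fintype.card N + 1) + 1)) :=
    Nat.mul_le_mul_left _ (by nlinarith [Nat.zero_le (2 ^ (Fintype.card N + 1))])
  refine l.alloc.mono (by norm_num) ?_ (by norm_num) ?_ <;>
    simp only [Fintype.card_prod, Fintype.card_option] <;> omega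

end Diagonal

/-! ### The binary tree of conditional amplitudes -/

section Tree

variable {n : ℕ}

/-- The inner nodes of the complete binary tree of depth `n`, as bit strings of length less than
`n`. -/
abbrev Node (n : ℕ) : Type := (k : Fin n) × (Fin k → Bool)

/-- The node at height `k` on the path from the root to the leaf `z`. -/
def branch (z : Fin n → Bool) (k : Fin n) : Node n := ⟨k, fun i => z (i.castLE k.is_lt.le)⟩

theorem branch_eq_iff {z : Fin n → Bool} {y : Node n} {k : Fin n} (hk : k = y.1) :
    branch z k = y ↔ ∀ i, y.2 i = z (i.castLE y.1.is_lt.le) := by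
  subst hk
  obtain ⟨k, p⟩ := y
  simp only [branch, Sigma.mk.injEq, heq_eq_eq, true_and, funext_iff]
  exact forall_congr' fun i => eq_comm

theorem branch_eq_branch_iff {z z' : Fin n → Bool} {k : Fin n} :
    branch z' k = branch z k ↔ ∀ i : Fin n, i.val < k.val → z' i = z i := by
  refine (branch_eq_iff (y := branch z k) rfl).trans ?_
  constructor
  · intro h i hi
    exact (h ⟨i, hi⟩).symm
  · intro h i
    exact (h _ i.is_lt).symm

theorem card_node_le : Fintype.card (Node n) ≤ 2 ^ n := by
  rw [Fintype.card_sigma]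
  simp only [Fintype.card_fun, Fintype.card_bool, Fintype.card_fin]
  rw [Fin.sum_univ_eq_sum_range (fun k => 2 ^ k), Nat.geomSum_eq le_rfl]
  simp

/-- Following the bits attached to the nodes leads from the root to exactly one leaf. -/
theorem existsUnique_path (q : Node n → Bool) :
    ∃ z : Fin n → Bool, ∀ z' : Fin n → Bool, (∀ k, q (branch z' k) = z' k) ↔ z' = z := by
  have hex : ∀ j : ℕ, ∃ z : Fin n → Bool, ∀ k : Fin n, k.val < j → q (branch z k) = z k := by
    intro j
    induction j with
    | zero => exact ⟨0, fun k hk => absurd hk (Nat.not_lt_zero _)⟩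
    | succ j ih =>
      obtain ⟨z, hz⟩ := ih
      by_cases hj : j < n
      -- The node at height `k` depends only on the bits below `k`, so setting bit `j` disturbs none
      -- of the equations up to height `j`.
      · refine ⟨update z ⟨j, hj⟩ (q (branch z ⟨j, hj⟩)), fun k hk => ?_⟩
        have hb : branch (update z ⟨j, hj⟩ (q (branch z ⟨j, hj⟩))) k = branch z k := by
          rw [branch_eq_branch_iff]
          intro i hi
          rw [update_of_ne]
          rintro rfl
          simp only at hi
          omega
        rw [hb]
        rcases Nat.lt_succ_iff_lt_or_eq.1 hk with h | h
        · rw [update_of_ne, hz k h]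
          rintro rfl
          simp at h
        · obtain rfl : k = ⟨j, hj⟩ := Fin.ext h
          simp
      · exact ⟨z, fun k _ => hz k (by omega)⟩
  obtain ⟨z, hz⟩ := hex n
  refine ⟨z, fun z' => ⟨fun h => ?_, fun h k => h ▸ hz k k.is_lt⟩⟩
  funext k
  obtain ⟨k, hk⟩ := k
  induction k using Nat.strong_induction_on with
  | _ k ih =>
    rw [← h, ← hz _ hk]
    congr 1
    exact branch_eq_branch_iff.2 fun i hi => ih i hi i.is_lt

theorem prod_lt_succ {M : Type} [CommMonoid M] (f : Fin n → M) (j : Fin n) :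
    ∏ i : Fin n, (if i.val < j.val + 1 then f i else 1) =
      (∏ i : Fin n, if i.val < j.val then f i else 1) * f j := by
  have : f j = ∏ i : Fin n, if i = j then f i else 1 := by simp
  rw [this, ← Finset.prod_mul_distrib]
  refine Finset.prod_congr rfl fun i _ => ?_
  rcases lt_trichotomy i j with h | h | h
  · have h' : i.val < j.val := h
    simp [h', h.ne, Nat.lt_succ_of_lt h']
  · subst h; simp
  · have h' : j.val < i.val := h
    simp [h.ne', show ¬ i.val < j.val by omega, show ¬ i.val < j.val + 1 by omega]

/-- A probability distribution on the leaves is the product of conditional probabilities along the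
branches. -/
theorem exists_conditional (p : (Fin n → Bool) → ℝ) (hp : ∀ z, 0 ≤ p z) (hsum : ∑ z, p z = 1) :
    ∃ c : Node n → Bool → ℝ, (∀ y b, 0 ≤ c y b) ∧ (∀ y, c y false + c y true = 1) ∧
      ∀ z, p z = ∏ k, c (branch z k) (z k) := by
  classical
  let mass : Node n → ℝ := fun y => ∑ z, if branch z y.1 = y then p z else 0
  let part : Node n → Bool → ℝ := fun y b => ∑ z, if branch z y.1 = y ∧ z y.1 = b then p z else 0
  have hmass : ∀ y, 0 ≤ mass y := fun y => Finset.sum_nonneg fun z _ => by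
    split_ifs
    exacts [hp z, le_rfl]
  have hpart : ∀ y b, 0 ≤ part y b := fun y b => Finset.sum_nonneg fun z _ => by
    split_ifs
    exacts [hp z, le_rfl]
  have hadd : ∀ y, part y false + part y true = mass y := by
    intro y
    simp only [part, mass, ← Finset.sum_add_distrib]
    refine Finset.sum_congr rfl fun z _ => ?_
    by_cases h : branch z y.1 = y <;> cases hz : z y.1 <;> simp [h]
  -- At a node of mass zero any distribution will do, since all leaves below it have probability
  -- zero; the point mass at `false` is chosen.
  let c : Node n → Bool → ℝ := fun y b =>
    if mass y = 0 then (if b then 0 else 1) else part y b / mass y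
  refine ⟨c, fun y b => ?_, fun y => ?_, fun z => ?_⟩
  · simp only [c]
    split_ifs
    exacts [le_rfl, zero_le_one, div_nonneg (hpart y b) (hmass y)]
  · by_cases h : mass y = 0
    · simp [c, h]
    · simp only [c, h, if_false]
      rw [← add_div, hadd, div_self h]
  -- `S j` is the mass of the leaves that agree with `z` in the first `j` bits; the conditional
  -- probabilities are its successive ratios.
  · let S : ℕ → ℝ := fun j => ∑ z', if ∀ i : Fin n, i.val < j → z' i = z i then p z' else 0
    have hS0 : ∀ k : Fin n, S k = mass (branch z k) := fun k =>
      Finset.sum_congr rfl fun z' _ => by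
        simp only [show (branch z k).1 = k from rfl, branch_eq_branch_iff]
    have hS1 : ∀ k : Fin n, S (k + 1) = part (branch z k) (z k) := fun k =>
      Finset.sum_congr rfl fun z' _ => by
        simp only [show (branch z k).1 = k from rfl, branch_eq_branch_iff]
        congr 1
        refine propext ⟨fun h => ⟨fun i hi => h i (by omega), h k (by omega)⟩, fun h i hi => ?_⟩
        rcases Nat.lt_succ_iff_lt_or_eq.1 hi with h' | h'
        · exact h.1 i h'
        · exact Fin.ext h' ▸ h.2
    have key : ∀ j ≤ n, ∏ k : Fin n, (if k.val < j then c (branch z k) (z k) else 1) = S j := by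
      intro j hj
      induction j with
      | zero => simp [S, hsum]
      | succ j ih =>
        have := prod_lt_succ (fun k => c (branch z k) (z k)) ⟨j, hj⟩
        rw [this, ih (by omega)]
        have h0 := hS0 ⟨j, hj⟩
        have h1 := hS1 ⟨j, hj⟩
        simp only at h0 h1
        rw [h0, h1]
        simp only [c]
        split_ifs with hm hz
        · rw [mul_zero]
          have := hadd (branch z ⟨j, hj⟩)
          rw [hm] at this
          rw [hz]
          linarith [hpart (branch z ⟨j, hj⟩) false, hpart (branch z ⟨j, hj⟩) true]
        · have := hadd (branch z ⟨j, hj⟩)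
          rw [hm] at this
          rw [hm, zero_mul, Bool.eq_false_of_not_eq_true hz]
          linarith [hpart (branch z ⟨j, hj⟩) false, hpart (branch z ⟨j, hj⟩) true]
        · field_simp
    have h := key n le_rfl
    simp only [Fin.is_lt, if_true] at h
    rw [h]
    simp only [S]
    rw [Fintype.sum_eq_single z]
    · simp
    · intro z' hz'
      rw [if_neg]
      exact fun h => hz' (funext fun i => h i i.is_lt)

theorem exists_amplitudes (α : (Fin n → Bool) → ℝ) (hα : ∀ z, 0 ≤ α z) (hsum : ∑ z, α z ^ 2 = 1) :
    ∃ c : Node n → Bool → ℝ, (∀ y b, 0 ≤ c y b) ∧ (∀ y, c y false ^ 2 + c y true ^ 2 = 1) ∧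
      ∀ z, α z = ∏ k, c (branch z k) (z k) := by
  obtain ⟨c, h0, h1, h⟩ := exists_conditional (fun z => α z ^ 2) (fun z => sq_nonneg _) hsum
  refine ⟨fun y b => √(c y b), fun y b => Real.sqrt_nonneg _, fun y => ?_, fun z => ?_⟩
  · rw [Real.sq_sqrt (h0 _ _), Real.sq_sqrt (h0 _ _), h1]
  · rw [← Real.sqrt_sq (hα z), h z, Real.sqrt_prod _ fun _ _ => h0 _ _]

end Tree

/-! ### One-qubit preparation by a conjugate of `X` -/

/-- The gate that rotates by the angle `β`. -/
noncomputable def rotation (β : ℝ) : Matrix.unitaryGroup Bool ℂ :=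
  ⟨Matrix.of fun i j => if i = j then (Real.cos β : ℂ) else if i then (Real.sin β : ℂ)
      else -(Real.sin β : ℂ), by
    have h : (Real.cos β : ℂ) * Real.cos β + Real.sin β * Real.sin β = 1 := by
      norm_cast
      rw [← Real.cos_sq_add_sin_sq β]
      ring
    rw [Matrix.mem_unitaryGroup_iff]
    ext i j
    rw [Matrix.mul_apply, Fintype.sum_bool]
    simp only [Matrix.star_apply, Matrix.of_apply, RCLike.star_def]
    cases i <;> cases j <;> simp only [reduceCtorEq, if_true, if_false, map_neg,
      Complex.conj_ofReal, Matrix.one_apply] <;> first | linear_combination h | ring⟩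

/-- Conjugating `X` by the rotation through `β` gives a reflection with first column `(-sin 2β, cos
2β)`; take `2β = arccos a - π/2`. Preparing by a conjugate of `X` allows a controlled undoing with
one CNOT. -/
theorem exists_conjugate_flip (a b : ℝ) (ha : 0 ≤ a) (hb : 0 ≤ b) (hab : a ^ 2 + b ^ 2 = 1) :
    ∃ W : Matrix.unitaryGroup Bool ℂ, ∀ i,
      ((W * flip true * W⁻¹ : Matrix.unitaryGroup Bool ℂ) : Matrix Bool Bool ℂ) i false =
        (if i then b else a : ℝ) := by
  set t := Real.arccos a with ht
  have hc : Real.cos t = a := Real.cos_arccos (by linarith) (by nlinarith)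
  have hs : Real.sin t = b := by
    rw [ht, Real.sin_arccos, show 1 - a ^ 2 = b ^ 2 by linarith, Real.sqrt_sq hb]
  set β := (t - Real.pi / 2) / 2 with hβ
  have h2 : 2 * β = t - Real.pi / 2 := by rw [hβ]; ring
  have h₁ : Real.cos β * Real.cos β - Real.sin β * Real.sin β = b := by
    have := Real.cos_sub_pi_div_two t
    rw [← h2, Real.cos_two_mul', hs] at this
    linarith
  have h₂ : 2 * (Real.sin β * Real.cos β) = -a := by
    have := Real.sin_sub_pi_div_two t
    rw [← h2, Real.sin_two_mul, hc] at this
    linarith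
  refine ⟨rotation β, fun i => ?_⟩
  have h₁' : (Real.cos β : ℂ) * Real.cos β - Real.sin β * Real.sin β = b := by exact_mod_cast h₁
  have h₂' : 2 * ((Real.sin β : ℂ) * Real.cos β) = -a := by exact_mod_cast h₂
  rw [Submonoid.coe_mul, Submonoid.coe_mul, ← Unitary.star_eq_inv, Unitary.coe_star]
  simp only [Matrix.mul_apply, Fintype.sum_bool, Matrix.star_apply, coe_flip, flipMatrix, rotation,
    Matrix.of_apply, RCLike.star_def, show ∀ a c : Bool, a + c = xor a c from fun _ _ => rfl]
  cases i <;> simp only [reduceCtorEq, if_true, if_false, map_neg, Complex.conj_ofReal,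
    Bool.xor_true, Bool.not_true, Bool.not_false]
  · linear_combination -h₂'
  · linear_combination h₁'

theorem flipMatrix_mulVec (b : Bool) (h : Bool → ℂ) :
    (flipMatrix b).mulVec h = fun i => h (i + b) := by
  funext i
  simp [Matrix.mulVec, dotProduct, flipMatrix]

theorem prod_ind {T : Type} [Fintype T] (p : T → Prop) : ∏ t, ind (p t) = ind (∀ t, p t) := by
  by_cases h : ∀ t, p t
  · rw [ind_true h]
    exact Finset.prod_eq_one fun t _ => ind_true (h t)
  · rw [ind_false h]
    obtain ⟨t, ht⟩ := not_forall.1 h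
    exact Finset.prod_eq_zero (Finset.mem_univ t) (ind_false ht)

/-! ### Moves on superpositions of leaves -/

section Preparation

variable {n : ℕ}

/-- The work registers: the amplitudes of the nodes, the unary encoding of the leaf, and the
indicators of the nodes on the path to the leaf. -/
abbrev Work (n : ℕ) : Type := Node n ⊕ ((Fin n → Bool) ⊕ Node n)

/-- The wires of the output register. -/
def outWire (i : Fin n) : Fin n ⊕ Work n := Sum.inl i

/-- The wires of the node register. -/
def nodeWire (y : Node n) : Fin n ⊕ Work n := Sum.inr (Sum.inl y)

/-- The wires of the leaf register. -/
def leafWire (z : Fin n → Bool) : Fin n ⊕ Work n := Sum.inr (Sum.inr (Sum.inl z))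

/-- The wires of the path register. -/
def pathWire (y : Node n) : Fin n ⊕ Work n := Sum.inr (Sum.inr (Sum.inr y))

theorem outWire_injective : Injective (outWire (n := n)) := Sum.inl_injective

theorem nodeWire_injective : Injective (nodeWire (n := n)) :=
  Sum.inr_injective.comp Sum.inl_injective

theorem leafWire_injective : Injective (leafWire (n := n)) :=
  Sum.inr_injective.comp (Sum.inr_injective.comp Sum.inl_injective)

theorem pathWire_injective : Injective (pathWire (n := n)) :=
  Sum.inr_injective.comp (Sum.inr_injective.comp Sum.inr_injective)

/-- A superposition over the leaves, with the leaf in unary encoding in the leaf register, basis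
states in the output and path registers, and a product state in the node register. -/
noncomputable def treeState (C : (Fin n → Bool) → ℂ) (O : (Fin n → Bool) → Fin n → Bool)
    (F : (Fin n → Bool) → Node n → Bool) (h : (Fin n → Bool) → Node n → Bool → ℂ) :
    QV (Fin n ⊕ Work n) := fun x =>
  ∑ z, ind (∀ z', x (leafWire z') = decide (z' = z)) * (ind (∀ i, x (outWire i) = O z i) *
    (ind (∀ y, x (pathWire y) = F z y) * (C z * ∏ y, h z y (x (nodeWire y)))))

variable {C : (Fin n → Bool) → ℂ} {O : (Fin n → Bool) → Fin n → Bool}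
  {F : (Fin n → Bool) → Node n → Bool} {h : (Fin n → Bool) → Node n → Bool → ℂ}

theorem extend_outWire (b : Fin n → Bool) (x : Fin n ⊕ Work n → Bool) :
    (∀ i, extend outWire b x (outWire i) = b i) ∧
    (∀ y, extend outWire b x (nodeWire y) = x (nodeWire y)) ∧
    (∀ z, extend outWire b x (leafWire z) = x (leafWire z)) ∧
    (∀ y, extend outWire b x (pathWire y) = x (pathWire y)) :=
  ⟨fun i => outWire_injective.extend_apply _ _ _,
    fun y => extend_apply' _ _ _ (by simp [outWire, nodeWire]),
    fun y => extend_apply' _ _ _ (by simp [outWire, leafWire]),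
    fun y => extend_apply' _ _ _ (by simp [outWire, pathWire])⟩

theorem extend_nodeWire (b : Node n → Bool) (x : Fin n ⊕ Work n → Bool) :
    (∀ i, extend nodeWire b x (outWire i) = x (outWire i)) ∧
    (∀ y, extend nodeWire b x (nodeWire y) = b y) ∧
    (∀ z, extend nodeWire b x (leafWire z) = x (leafWire z)) ∧
    (∀ y, extend nodeWire b x (pathWire y) = x (pathWire y)) :=
  ⟨fun y => extend_apply' _ _ _ (by simp [nodeWire, outWire]),
    fun i => nodeWire_injective.extend_apply _ _ _,
    fun y => extend_apply' _ _ _ (by simp [nodeWire, leafWire]),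
    fun y => extend_apply' _ _ _ (by simp [nodeWire, pathWire])⟩

theorem extend_leafWire (b : (Fin n → Bool) → Bool) (x : Fin n ⊕ Work n → Bool) :
    (∀ i, extend leafWire b x (outWire i) = x (outWire i)) ∧
    (∀ y, extend leafWire b x (nodeWire y) = x (nodeWire y)) ∧
    (∀ z, extend leafWire b x (leafWire z) = b z) ∧
    (∀ y, extend leafWire b x (pathWire y) = x (pathWire y)) :=
  ⟨fun y => extend_apply' _ _ _ (by simp [leafWire, outWire]),
    fun y => extend_apply' _ _ _ (by simp [leafWire, nodeWire]),
    fun i => leafWire_injective.extend_apply _ _ _,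
    fun y => extend_apply' _ _ _ (by simp [leafWire, pathWire])⟩

theorem extend_pathWire (b : Node n → Bool) (x : Fin n ⊕ Work n → Bool) :
    (∀ i, extend pathWire b x (outWire i) = x (outWire i)) ∧
    (∀ y, extend pathWire b x (nodeWire y) = x (nodeWire y)) ∧
    (∀ z, extend pathWire b x (leafWire z) = x (leafWire z)) ∧
    (∀ y, extend pathWire b x (pathWire y) = b y) :=
  ⟨fun y => extend_apply' _ _ _ (by simp [pathWire, outWire]),
    fun y => extend_apply' _ _ _ (by simp [pathWire, nodeWire]),
    fun y => extend_apply' _ _ _ (by simp [pathWire, leafWire]),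
    fun i => pathWire_injective.extend_apply _ _ _⟩

theorem bool_add_eq_iff {a b c : Bool} : a + b = c ↔ a = c + b := by
  rw [show a + b = xor a b from rfl, show c + b = xor c b from rfl]
  cases a <;> cases b <;> cases c <;> decide

/-- In unary encoding every Boolean function of the leaf is linear in the leaf register; hence
linear maps suffice for all computations from the leaf. -/
theorem sum_mul_of_unary {x : (Fin n → Bool) → Bool} {z : Fin n → Bool}
    (hx : ∀ z', x z' = decide (z' = z)) (A : (Fin n → Bool) → Bool) :
    ∑ z', A z' * x z' = A z := by
  rw [Fintype.sum_eq_single z]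
  · rw [hx, decide_eq_true rfl]
    exact mul_one _
  · intro z' hz
    rw [hx, decide_eq_false hz]
    exact mul_zero _

theorem Prep.treeState_node (U : Node n → Matrix.unitaryGroup Bool ℂ) :
    Prep (treeState C O F h)
      (treeState C O F fun z y => (U y : Matrix Bool Bool ℂ).mulVec (h z y))
      1 (Fintype.card (Node n)) 0 0 := by
  convert Prep.parOp nodeWire_injective U (treeState C O F h) using 1
  funext x
  simp only [treeState, DynamicCircuit.parOp, extend_nodeWire, Finset.mul_sum]
  rw [Finset.sum_comm]
  refine Finset.sum_congr rfl fun z _ => ?_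
  simp only [Matrix.mulVec, dotProduct, Fintype.prod_sum, Finset.prod_mul_distrib, Finset.mul_sum]
  exact Finset.sum_congr rfl fun b _ => by ring

theorem Prep.treeState_phase (θ : (Fin n → Bool) → ℝ) :
    Prep (treeState C O F h) (treeState (fun z => C z * Complex.exp (θ z * Complex.I)) O F h)
      1 (2 ^ n) 0 0 := by
  have hp := Prep.parOp leafWire_injective (fun z => phase fun b => if b then θ z else 0)
    (treeState C O F h)
  simp only [Fintype.card_fun, Fintype.card_bool, Fintype.card_fin] at hp
  convert hp using 1
  funext x
  simp only [coe_phase, parOp_diagonal, treeState, Finset.mul_sum]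
  refine Finset.sum_congr rfl fun z _ => ?_
  conv_rhs => rw [mul_left_comm]
  refine ind_mul_congr fun hx => ?_
  rw [Fintype.prod_eq_single z]
  · simp only [hx, decide_true, if_true]
    ring
  · intro z' hz
    simp [hx, hz]

theorem Prep.treeState_leaf_node (A : Node n → (Fin n → Bool) → Bool) :
    Prep (treeState C O F h) (treeState C O F fun z y b => h z y (b + A y z)) 11
      (22 * (2 ^ n * (Fintype.card (Node n) + 1))) 2
      (22 * (2 ^ n * (Fintype.card (Node n) + 1))) := by
  have hp := Prep.linear_single (treeState C O F h) leafWire nodeWire leafWire_injective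
    nodeWire_injective (by simp [leafWire, nodeWire]) A
  simp only [Fintype.card_fun, Fintype.card_bool, Fintype.card_fin] at hp
  convert hp using 1
  funext x
  simp only [treeState, extend_nodeWire]
  refine Finset.sum_congr rfl fun z _ => ind_mul_congr fun hx => ?_
  simp only [sum_mul_of_unary hx]

theorem Prep.treeState_leaf_out (A : Fin n → (Fin n → Bool) → Bool) :
    Prep (treeState C O F h) (treeState C (fun z i => O z i + A i z) F h) 11
      (22 * (2 ^ n * (n + 1))) 2 (22 * (2 ^ n * (n + 1))) := by
  have hp := Prep.linear_single (treeState C O F h) leafWire outWire leafWire_injective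
    outWire_injective (by simp [leafWire, outWire]) A
  simp only [Fintype.card_fun, Fintype.card_bool, Fintype.card_fin] at hp
  convert hp using 1
  funext x
  simp only [treeState, extend_outWire]
  refine Finset.sum_congr rfl fun z _ => ind_mul_congr fun hx => ?_
  simp only [sum_mul_of_unary hx, bool_add_eq_iff]

theorem Prep.treeState_leaf_path (A : Node n → (Fin n → Bool) → Bool) :
    Prep (treeState C O F h) (treeState C O (fun z y => F z y + A y z) h) 11
      (22 * (2 ^ n * (Fintype.card (Node n) + 1))) 2
      (22 * (2 ^ n * (Fintype.card (Node n) + 1))) := by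
  have hp := Prep.linear_single (treeState C O F h) leafWire pathWire leafWire_injective
    pathWire_injective (by simp [leafWire, pathWire]) A
  simp only [Fintype.card_fun, Fintype.card_bool, Fintype.card_fin] at hp
  convert hp using 1
  funext x
  simp only [treeState, extend_pathWire]
  refine Finset.sum_congr rfl fun z _ => ind_mul_congr fun hx => ?_
  simp only [sum_mul_of_unary hx, bool_add_eq_iff]

theorem Prep.treeState_path_node :
    Prep (treeState C O F h) (treeState C O F fun z y => (flipMatrix (F z y)).mulVec (h z y)) 1
      (Fintype.card (Node n)) 0 0 := by
  convert Prep.cnotOp pathWire_injective nodeWire_injective (by simp [pathWire, nodeWire])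
    (treeState C O F h) using 1
  funext x
  simp only [treeState, DynamicCircuit.cnotOp, extend_nodeWire, flipMatrix_mulVec]
  refine Finset.sum_congr rfl fun z _ => ?_
  congr 2
  exact ind_mul_congr fun hx => by simp only [hx]

/-- From a product state of the node register, the leaf reached by following the bits of the nodes
is computed into the leaf register. -/
theorem Prep.treeState_of_product [NeZero n] (r : Node n → Bool → ℂ) :
    Prep (fun x => ind (∀ z, x (leafWire z) = 0) * (ind (∀ i : Fin n, x (outWire i) = 0) *
        (ind (∀ y : Node n, x (pathWire y) = 0) * ∏ y, r y (x (nodeWire y)))))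
      (treeState 1 0 0 fun z y b => if branch z y.1 = y then ind (b = z y.1) * r y b else r y b) 47
      (44 * (Fintype.card (Node n) * (2 ^ n * n + 1)) +
        47 * (2 ^ n * ((n + 1) * (2 ^ (n + 1) + 1)))) 8
      (44 * (Fintype.card (Node n) * (2 ^ n * n + 1)) +
        46 * (2 ^ n * ((n + 1) * (2 ^ (n + 1) + 1)))) := by
  have : Nonempty (Node n) := ⟨⟨⟨0, NeZero.pos n⟩, fun i => i.elim0⟩⟩
  have hp := Prep.conjunction (I := Node n) (G := Fin n → Bool) (N := Fin n)
    (fun x => ind (∀ z, x (leafWire z) = 0) * (ind (∀ i : Fin n, x (outWire i) = 0) *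
        (ind (∀ y : Node n, x (pathWire y) = 0) * ∏ y, r y (x (nodeWire y)))))
    nodeWire leafWire nodeWire_injective leafWire_injective (by simp [leafWire, nodeWire])
    branch (fun z => z)
  simp only [Fintype.card_fun, Fintype.card_bool, Fintype.card_fin] at hp
  convert hp using 1
  funext x
  simp only [treeState, extend_leafWire, bool_add_eq_zero]
  -- For fixed node bits only the leaf they lead to has a nonzero term, so the product state splits
  -- into the sum over leaves.
  obtain ⟨z, hz⟩ := existsUnique_path fun y => x (nodeWire y)
  simp only [eqBit, hz]
  rw [Fintype.sum_eq_single z]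
  · refine ind_mul_congr fun _ => ind_mul_congr fun _ => ind_mul_congr fun _ => ?_
    rw [Pi.one_apply, one_mul]
    refine Finset.prod_congr rfl fun y _ => ?_
    split_ifs with hy
    · rw [ind_true, one_mul]
      have := (hz z).2 rfl y.1
      rwa [hy] at this
    · rfl
  · intro z' hz'
    obtain ⟨k, hk⟩ : ∃ k, x (nodeWire (branch z' k)) ≠ z' k := by
      by_contra! hk
      exact hz' ((hz z').1 hk)
    rw [Finset.prod_eq_zero (Finset.mem_univ (branch z' k))]
    · simp
    · refine (if_pos (show branch z' (branch z' k).1 = branch z' k from rfl)).trans ?_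
      exact mul_eq_zero_of_left (ind_false hk) _

/-- When the leaf is in the output register and the other registers are in the state `|0⟩`, the
leaf register is reset. -/
theorem Prep.treeState_reset [NeZero n] :
    Prep (treeState C (fun z => z) 0 fun _ _ b => ind (b = 0)) (embedVec Sum.inl C) 47
      (44 * (n * (2 ^ n * n + 1)) + 47 * (2 ^ n * ((n + 1) * (2 ^ (n + 1) + 1)))) 8
      (44 * (n * (2 ^ n * n + 1)) + 46 * (2 ^ n * ((n + 1) * (2 ^ (n + 1) + 1)))) := by
  have hp := Prep.conjunction (I := Fin n) (G := Fin n → Bool) (N := Fin n)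
    (treeState C (fun z => z) 0 fun _ _ b => ind (b = 0))
    outWire leafWire outWire_injective leafWire_injective (by simp [leafWire, outWire])
    (fun _ k => k) (fun z => z)
  simp only [Fintype.card_fun, Fintype.card_bool, Fintype.card_fin] at hp
  convert hp using 1
  funext x
  simp only [treeState, extend_leafWire, embedVec_inl]
  -- The output register holds the leaf, so it alone determines which unary bit to clear.
  rw [Fintype.sum_eq_single (x ∘ outWire)]
  · have h₁ : ∀ z', eqBit (fun k => x (outWire k)) z' = decide (z' = x ∘ outWire) := by
      intro z'
      rw [eqBit, decide_eq_decide, funext_iff]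
      exact forall_congr' fun k => eq_comm
    simp only [h₁, bool_add_eq_right]
    rw [prod_ind, ind_true (p := ∀ i, x (outWire i) = (x ∘ outWire) i) fun _ => rfl, one_mul,
      mul_comm (C _), ← mul_assoc, ← mul_assoc, ← ind_and, ← ind_and]
    congr 2
    refine propext ⟨fun hx => ⟨⟨fun z => hx _, fun y => hx _⟩, fun y => hx _⟩, ?_⟩
    rintro ⟨⟨he, hf⟩, hq⟩ (y | z | y)
    exacts [hq y, he z, hf y]
  · intro z hz
    rw [ind_false (p := ∀ i, x (outWire i) = z i)]
    · simp
    · exact fun hx => hz (funext fun i => (hx i).symm)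

end Preparation

theorem flip_mul_self (b : Bool) : flip b * flip b = 1 := by
  refine Subtype.ext ?_
  ext i j
  simp only [Submonoid.coe_mul, coe_flip, Matrix.mul_apply, Fintype.sum_bool, flipMatrix,
    show ∀ a c : Bool, a + c = xor a c from fun _ _ => rfl]
  cases i <;> cases j <;> cases b <;> simp

/-- The basis vector `|0⟩`, of one qubit. -/
noncomputable def zeroVec : Bool → ℂ := fun b => ind (b = 0)

theorem mulVec_zeroVec (M : Matrix Bool Bool ℂ) : M.mulVec zeroVec = fun i => M i false := by
  funext i
  simp [Matrix.mulVec, dotProduct, zeroVec, ind, Bool.zero_eq_false]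

/-! ### Assembling the state -/

section State

variable {n : ℕ}

theorem embedVec_ket_zero (x : Fin n ⊕ Work n → Bool) :
    embedVec Sum.inl (ket fun _ => false) x =
      ind (∀ z : Fin n → Bool, x (leafWire z) = 0) * (ind (∀ i : Fin n, x (outWire i) = 0) *
        (ind (∀ y : Node n, x (pathWire y) = 0) * ∏ y : Node n, zeroVec (x (nodeWire y)))) := by
  have hk : ∀ z : Fin n → Bool, ket (fun _ => false) z = ind (∀ i, z i = 0) := by
    intro z
    by_cases h : z = fun _ => false
    · rw [h, ket, Pi.single_eq_same]
      exact (ind_true fun _ => rfl).symm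
    · rw [ket, Pi.single_eq_of_ne h]
      exact (ind_false fun hz => h (funext hz)).symm
  rw [embedVec_inl, hk]
  simp only [zeroVec, prod_ind, ← ind_and]
  congr 1
  refine propext ⟨fun ⟨h, ho⟩ => ⟨fun z => h _, ho, fun y => h _, fun y => h _⟩, ?_⟩
  rintro ⟨he, ho, hf, hq⟩
  refine ⟨?_, ho⟩
  rintro (y | z | y)
  exacts [hq y, he z, hf y]

theorem Prep.product_of_zero (U : Node n → Matrix.unitaryGroup Bool ℂ) :
    Prep (embedVec Sum.inl (ket fun _ => false)) (fun x =>
      ind (∀ z : Fin n → Bool, x (leafWire z) = 0) * (ind (∀ i : Fin n, x (outWire i) = 0) *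
        (ind (∀ y : Node n, x (pathWire y) = 0) *
          ∏ y : Node n, (U y : Matrix Bool Bool ℂ).mulVec zeroVec (x (nodeWire y)))))
      1 (Fintype.card (Node n)) 0 0 := by
  convert Prep.parOp nodeWire_injective U (embedVec Sum.inl (ket fun _ => false)) using 1
  funext x
  simp only [DynamicCircuit.parOp, embedVec_ket_zero, extend_nodeWire, Matrix.mulVec, dotProduct,
    Fintype.prod_sum, Finset.prod_mul_distrib, Finset.mul_sum]
  exact Finset.sum_congr rfl fun b _ => by ring

/-- On the path, the CNOT supplies a second `X` that cancels the first, and the sequence acts as the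
identity on the already cleared qubit. -/
theorem reset_on_path (W : Matrix.unitaryGroup Bool ℂ) (v : Bool → ℂ) :
    (W : Matrix Bool Bool ℂ).mulVec ((flipMatrix true).mulVec
      (((flip true * W⁻¹ : Matrix.unitaryGroup Bool ℂ) : Matrix Bool Bool ℂ).mulVec v)) = v := by
  rw [← coe_flip, Matrix.mulVec_mulVec, Matrix.mulVec_mulVec, ← Submonoid.coe_mul,
    ← Submonoid.coe_mul]
  have : W * flip true * (flip true * W⁻¹) = 1 := by
    have hf := flip_mul_self true
    calc _ = W * (flip true * flip true) * W⁻¹ := by group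
      _ = 1 := by rw [hf]; group
  rw [this]
  simp

/-- Off the path the CNOT is idle, and the sequence is the involution `W X W⁻¹`, which undoes the
preparation. -/
theorem reset_off_path (W : Matrix.unitaryGroup Bool ℂ) (v : Bool → ℂ) :
    (W : Matrix Bool Bool ℂ).mulVec ((flipMatrix false).mulVec
      (((flip true * W⁻¹ : Matrix.unitaryGroup Bool ℂ) : Matrix Bool Bool ℂ).mulVec
        (((W * flip true * W⁻¹ : Matrix.unitaryGroup Bool ℂ) : Matrix Bool Bool ℂ).mulVec v))) =
      v := by
  have h : ∀ u : Bool → ℂ, (flipMatrix false).mulVec u = u := by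
    intro u
    rw [flipMatrix_mulVec]
    exact funext fun i => congrArg u (add_zero i)
  rw [h, Matrix.mulVec_mulVec, Matrix.mulVec_mulVec, ← Submonoid.coe_mul, ← Submonoid.coe_mul]
  have : W * (flip true * W⁻¹) * (W * flip true * W⁻¹) = 1 := by
    have hf := flip_mul_self true
    calc _ = W * (flip true * flip true) * W⁻¹ := by group
      _ = 1 := by rw [hf]; group
  rw [this]
  simp

theorem prod_branch (z : Fin n → Bool) (r : Node n → Bool → ℂ) :
    ∏ y : Node n, (if branch z y.1 = y then r y (z y.1) else 1) =
      ∏ k, r (branch z k) (z k) := by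
  rw [Fintype.prod_sigma]
  refine Finset.prod_congr rfl fun k _ => ?_
  refine (Fintype.prod_eq_single (branch z k).2 ?_).trans ?_
  · intro p hp
    refine if_neg fun h => hp ?_
    exact (eq_of_heq (Sigma.mk.inj_iff.1 h).2).symm
  · exact if_pos rfl

/-- Used with `N = 2 ^ n` and `M` the number of inner nodes: each kind of step stays within a
constant times `n 4 ^ n`. -/
theorem cost_bounds {n M N : ℕ} (hn : 1 ≤ n) (hM : M ≤ N) (hN : n + 1 ≤ N) :
    N ≤ n * (N * N) ∧ M * (N * n + 1) ≤ 2 * (n * (N * N)) ∧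
      N * ((n + 1) * (2 * N + 1)) ≤ 6 * (n * (N * N)) ∧ N * (M + 1) ≤ 2 * (n * (N * N)) ∧
      N * (n + 1) ≤ n * (N * N) ∧ n * (N * n + 1) ≤ n * (N * N) := by
  have h₀ : N * N ≤ n * (N * N) := Nat.le_mul_of_pos_left _ hn
  refine ⟨le_trans (by nlinarith) h₀, ?_, ?_, ?_, (Nat.mul_le_mul_left _ hN).trans h₀,
    Nat.mul_le_mul_left _ (by nlinarith)⟩
  · calc M * (N * n + 1) ≤ N * (N * n + N * n) := Nat.mul_le_mul hM (by nlinarith)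
      _ = 2 * (n * (N * N)) := by ring
  · calc N * ((n + 1) * (2 * N + 1)) ≤ N * ((2 * n) * (3 * N)) :=
          Nat.mul_le_mul_left _ (Nat.mul_le_mul (by omega) (by omega))
      _ = 6 * (n * (N * N)) := by ring
  · nlinarith

theorem Prep.polar_state [NeZero n] (α θ : (Fin n → Bool) → ℝ) (hα : ∀ z, 0 ≤ α z)
    (hsum : ∑ z, α z ^ 2 = 1) :
    Prep (ket fun _ => false) (fun z => (α z : ℂ) * Complex.exp (θ z * Complex.I))
      143 (1000 * (n * 4 ^ n)) 24 (1000 * (n * 4 ^ n)) := by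
  obtain ⟨c, hc0, hc1, hc⟩ := exists_amplitudes α hα hsum
  choose W hW using fun y => exists_conjugate_flip (c y false) (c y true) (hc0 _ _) (hc0 _ _) (hc1 y)
  set r : Node n → Bool → ℂ := fun y =>
    ((W y * flip true * (W y)⁻¹ : Matrix.unitaryGroup Bool ℂ) : Matrix Bool Bool ℂ).mulVec zeroVec
    with hr
  have hrc : ∀ y b, r y b = c y b := by
    intro y b
    rw [hr]
    simp only [mulVec_zeroVec]
    refine (hW y b).trans ?_
    cases b <;> rfl
  have l₁ := (Prep.product_of_zero fun y => W y * flip true * (W y)⁻¹).trans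
    (Prep.treeState_of_product r)
  -- A node on the path holds the corresponding bit of the leaf; adding that bit from the leaf
  -- register clears it.
  have l₂ := (l₁.trans (Prep.treeState_phase θ)).trans
    (Prep.treeState_leaf_node fun y z => decide (branch z y.1 = y) * z y.1)
  have l₃ := (l₂.trans (Prep.treeState_leaf_out fun i z => z i)).trans
    (Prep.treeState_leaf_path fun y z => decide (branch z y.1 = y))
  have l₄ := ((l₃.trans (Prep.treeState_node fun y => flip true * (W y)⁻¹)).trans
    Prep.treeState_path_node).trans (Prep.treeState_node W)
  have l₅ := l₄.trans (Prep.treeState_leaf_path fun y z => decide (branch z y.1 = y))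
  -- Every node ends in `|0⟩`; those on the path leave their conditional amplitude as a factor, and
  -- these factors multiply to `α z`.
  have hreset : ∀ (z : Fin n → Bool) (y : Node n), (W y : Matrix Bool Bool ℂ).mulVec
      ((flipMatrix ((0 : (Fin n → Bool) → Node n → Bool) z y + decide (branch z y.1 = y))).mulVec
        (((flip true * (W y)⁻¹ : Matrix.unitaryGroup Bool ℂ) : Matrix Bool Bool ℂ).mulVec
          fun b => if branch z y.1 = y then
            ind (b + decide (branch z y.1 = y) * z y.1 = z y.1) *
              r y (b + decide (branch z y.1 = y) * z y.1)
            else r y (b + decide (branch z y.1 = y) * z y.1))) =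
      (if branch z y.1 = y then r y (z y.1) else 1) • zeroVec := by
    intro z y
    rw [Pi.zero_apply, Pi.zero_apply]
    by_cases h : branch z y.1 = y
    · simp only [h, decide_true, if_true]
      rw [show (0 : Bool) + true = true from rfl, reset_on_path]
      funext b
      rw [show true * z y.1 = z y.1 from one_mul _, bool_add_eq_right, Pi.smul_apply, smul_eq_mul,
        mul_comm (r _ _)]
      refine ind_mul_congr fun hb => ?_
      rw [hb, zero_add]
    · simp only [h, decide_false, if_false]
      rw [show (0 : Bool) + false = false from rfl, one_smul]
      have : (fun b => r y (b + false * z y.1)) = r y := by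
        funext b
        rw [show false * z y.1 = 0 from zero_mul _, add_zero]
      rw [this]
      exact reset_off_path (W y) zeroVec
  have key : ∀ (z : Fin n → Bool) (x : Node n → Bool),
      (1 : (Fin n → Bool) → ℂ) z * Complex.exp (θ z * Complex.I) *
        ∏ y : Node n, ((if branch z y.1 = y then r y (z y.1) else 1) • zeroVec) (x y) =
      (α z : ℂ) * Complex.exp (θ z * Complex.I) * ∏ y : Node n, ind (x y = 0) := by
    intro z x
    simp only [Pi.smul_apply, smul_eq_mul, Finset.prod_mul_distrib, zeroVec]
    rw [prod_branch z r]
    simp only [hrc]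
    rw [hc z, Complex.ofReal_prod, Pi.one_apply]
    ring
  have hstate : treeState (fun z => (1 : (Fin n → Bool) → ℂ) z * Complex.exp (θ z * Complex.I))
      (fun z i => (0 : (Fin n → Bool) → Fin n → Bool) z i + z i)
      (fun z y => (0 : (Fin n → Bool) → Node n → Bool) z y + decide (branch z y.1 = y) +
        decide (branch z y.1 = y))
      (fun z y => (if branch z y.1 = y then r y (z y.1) else 1) • zeroVec) =
      treeState (fun z => (α z : ℂ) * Complex.exp (θ z * Complex.I)) (fun z => z) 0
        fun _ _ b => ind (b = 0) := by
    funext x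
    simp only [treeState, key, bool_add_self, Pi.zero_apply, zero_add]
  simp only [hreset] at l₅
  rw [hstate] at l₅
  have hn : 1 ≤ n := NeZero.one_le
  obtain ⟨b₁, b₂, b₃, b₄, b₅, b₆⟩ := cost_bounds hn (card_node_le (n := n)) Nat.lt_two_pow_self
  have hM := card_node_le (n := n)
  rw [show n * 4 ^ n = n * (2 ^ n * 2 ^ n) by rw [← mul_pow]; norm_num]
  refine (Prep.alloc (T := Work n) (l₅.trans Prep.treeState_reset)).mono (by norm_num) ?_
    (by norm_num) ?_ <;>
    simp only [Fintype.card_sum, Fintype.card_fun, Fintype.card_bool, Fintype.card_fin, pow_succ']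
      at * <;> omega

/-- For `n = 0` the bound `n 4 ^ n` is zero, so no gate or ancilla is available; the only amplitude
has modulus one and is a global phase. -/
theorem Prep.polar_state_zero (α θ : (Fin 0 → Bool) → ℝ) (hα : ∀ z, 0 ≤ α z)
    (hsum : ∑ z, α z ^ 2 = 1) :
    Prep (ket fun _ => false) (fun z => (α z : ℂ) * Complex.exp (θ z * Complex.I)) 0 0 0 0 := by
  rw [Fintype.sum_eq_single (fun _ => false) fun z hz => absurd (Subsingleton.elim _ _) hz] at hsum
  have h1 := (pow_eq_one_iff_of_nonneg (hα _) two_ne_zero).1 hsum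
  refine Prep.ofReaches (.done _ _ _ _ _ _ fun _ =>
    ⟨Complex.exp (-(θ (fun _ => false) * Complex.I)), funext fun z => ?_⟩)
  obtain rfl : z = fun _ => false := Subsingleton.elim _ _
  rw [Pi.smul_apply, smul_eq_mul, h1, ket, Pi.single_eq_same, Complex.ofReal_one, one_mul,
    ← Complex.exp_add]
  simp

theorem bits_bijective : Function.Bijective (bits (n := n)) := by
  rw [Fintype.bijective_iff_injective_and_card]
  refine ⟨fun i j hij => Fin.ext (Nat.eq_of_testBit_eq fun k => ?_), by simp⟩
  by_cases hk : k < n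
  · have := congrFun hij (Fin.rev ⟨k, hk⟩)
    simpa [bits] using this
  · have hp : 2 ^ n ≤ 2 ^ k := Nat.pow_le_pow_right (by norm_num) (by omega)
    rw [Nat.testBit_lt_two_pow (i.is_lt.trans_le hp), Nat.testBit_lt_two_pow (j.is_lt.trans_le hp)]

theorem polarState_apply (α θ : Fin (2 ^ n) → ℝ) (j : Fin (2 ^ n)) :
    polarState α θ (bits j) = (α j : ℂ) * Complex.exp (θ j * Complex.I) := by
  rw [polarState, Finset.sum_apply, Fintype.sum_eq_single j]
  · simp [ket, mul_comm]
  · intro i hi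
    rw [Pi.smul_apply, ket, Pi.single_eq_of_ne (bits_bijective.1.ne hi.symm), smul_zero]

end State

end DynamicCircuit

theorem mainTheorem1 :
    ∃ D K : ℕ, ∀ (n : ℕ) (α θ : Fin (2 ^ n) → ℝ),
      (∀ j, α j ∈ Set.Icc (0 : ℝ) 1) →
      (∀ j, θ j ∈ Set.Ico (0 : ℝ) (2 * Real.pi)) →
      ∑ j, α j ^ 2 = 1 →
      ∃ (a : ℕ) (C : DynamicCircuit.Circuit (n + a)),
        DynamicCircuit.Circuit.Prepares C (DynamicCircuit.polarState α θ) ∧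
        DynamicCircuit.Circuit.depth C ≤ D ∧
        DynamicCircuit.Circuit.size C ≤ K * (n * 4 ^ n) ∧
        a ≤ K * (n * 4 ^ n) ∧
        DynamicCircuit.Circuit.measureLayers C ≤ 31 := by
  -- The depth is two conjunctions of depth 47, four linear maps of depth 11 and five single gate
  -- layers. Measurements take 8 layers per conjunction and 2 per linear map, 24 in all.
  refine ⟨143, 1000, fun n α θ hα _ hsum => ?_⟩
  let e : Fin (2 ^ n) ≃ (Fin n → Bool) := Equiv.ofBijective _ DynamicCircuit.bits_bijective
  have hψ : DynamicCircuit.polarState α θ = fun z =>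
      (α (e.symm z) : ℂ) * Complex.exp (θ (e.symm z) * Complex.I) := by
    funext z
    obtain ⟨j, rfl⟩ := e.surjective z
    rw [e.symm_apply_apply]
    exact DynamicCircuit.polarState_apply α θ j
  have hsum' : ∑ z, α (e.symm z) ^ 2 = 1 := by
    rw [← hsum]
    exact Equiv.sum_comp e.symm fun j => α j ^ 2
  have h : DynamicCircuit.Prep (DynamicCircuit.ket fun _ => false)
      (DynamicCircuit.polarState α θ) 143 (1000 * (n * 4 ^ n)) 31 (1000 * (n * 4 ^ n)) := by
    rw [hψ]
    rcases n with _ | n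
    · exact (DynamicCircuit.Prep.polar_state_zero _ (fun z => θ (e.symm z))
        (fun z => (hα (e.symm z)).1) hsum').mono (by norm_num) (by norm_num) (by norm_num)
        (by norm_num)
    · exact (DynamicCircuit.Prep.polar_state _ (fun z => θ (e.symm z))
        (fun z => (hα (e.symm z)).1) hsum').mono le_rfl le_rfl (by norm_num) le_rfl
  exact h.exists_circuit
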